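/- Let $n\ge 2$. For $\ell\ge 1$ let $B_\ell$ be the $sl_n$ crystal of one-row semistandard tableaux of width $\ell$ with letters $1,\dots,n$, and let $B_\natural$ be the $sl_n$ crystal of one-column tableaux of height two with entries $\alpha<\beta$ in $\{1,\dots,n\}$, both with their standard operators $\tilde f_i$ ($1\le i\le n-1$); on tensor products, $\tilde f_i(b\otimes b')=\tilde f_i b\otimes b'$ if $\varphi_i(b)>\varepsilon_i(b')$ and $\tilde f_i(b\otimes b')=b\otimes\tilde f_i b'$ otherwise. Let $u_\ell\in B_\ell$ be the row all of whose letters are $1$ and $u_\natural\in B_\natural$ the column with entries $1,2$. Fix positive integers $\ell_1,\ell_2,\dots$ and let $\mathcal P$ be the set of inhomogeneous paths $p=p_1\otimes p_2\otimes\cdots$ with $p_i\in B_{\ell_i}$ for all $i$ and $p_i=u_{\ell_i}$ for all sufficiently large $i$. For $\ell\ge1$ define $T_\ell$ and $T_\natural$ by moving $u_\ell$, respectively $u_\natural$, successively through all positions of a path with the unique crystal isomorphisms $B_\ell\otimes B_{\ell_i}\simeq B_{\ell_i}\otimes B_\ell$ and $B_\natural\otimes B_{\ell_i}\simeq B_{\ell_i}\otimes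 B_\natural$: $$u_\ell\otimes p\mapsto T_\ell(p)\otimes u_\ell,\qquad u_\natural\otimes p\mapsto T_\natural(p)\otimes b(p).$$ Then for every $\ell\ge 1$ and every $p\in\mathcal P$: 1. The operators are well defined: $T_\ell(p)\in\mathcal P$ and the element of $B_\ell$ that is moved through $p$ is equal to $u_\ell$ from some position on; $T_\natural(p)\in\mathcal P$ and the element of $B_\natural$ that is moved through $p$ is from some position on equal to a fixed column $b(p)$, which contains the letter $1$. 2. The decoding terminates: there is an $N_0$ such that for all $N\ge N_0$ neither $(T_\natural)^N(p)$ nor $(T_\natural)^N(T_\ell(p))$ contains a letter $\ge 3$. If $(T_\natural)^N(p)$ and $(T_\natural)^{N'}(p)$ both contain no letter $\ge3$, they are equal; this common value is the reduced form $\tilde p$ of $p$. 3. Colour separates from dynamics: let $N\ge 0$ be such that $\tilde p=(T_\natural)^N(p)$ and $\widetilde{T_\ell(p)}=(T_\natural)^N(T_\ell(p))$ contain no letter $\ge3$. Then $$T_\ell(\tilde p)=\widetilde{T_\ell(p)},\qquad b\big((T_\natural)^{N-i}(p)\big)=b\big((T_\natural)^{N-i}(T_\ell(p))\big)\quad(1\le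 i\le N).$$ In particular the colour words $y_1\cdots y_N$ of $p$ and of $T_\ell(p)$ coincide, where $y_i$ is the letter other than $1$ in $b((T_\natural)^{N-i}(p))$, respectively in $b((T_\natural)^{N-i}(T_\ell(p)))$. -/

import Mathlib

namespace BoxBall

/-! ### Maxima over cyclic windows

Technical preparation for the piecewise linear map `rowRowMap` below: it is well defined, an
involution, and commutes with the crystal operators. -/

/-- `P_i = max_{0 ≤ j < n} (∑_{k < j} (Y_{i+k} - X_{i+k}) + Y_{i+j})`. -/
def windowMax (n : ℕ) [NeZero n] (X Y : ℕ → ℤ) (i : ℕ) : ℤ :=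
  (Finset.range n).sup' ⟨0, Finset.mem_range.2 (NeZero.pos n)⟩
    fun j => ∑ k ∈ Finset.range j, (Y (i + k) - X (i + k)) + Y (i + j)

section Window

variable {n : ℕ} {X Y : ℕ → ℤ}

/-- Partial sums of `Y - X`. -/
def partialDiff (X Y : ℕ → ℤ) (i : ℕ) : ℤ := ∑ k ∈ Finset.range i, (Y k - X k)

theorem partialDiff_succ (X Y : ℕ → ℤ) (i : ℕ) :
    partialDiff X Y (i + 1) = partialDiff X Y i + (Y i - X i) := Finset.sum_range_succ _ _

theorem partialDiff_add (X Y : ℕ → ℤ) (i j : ℕ) :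
    ∑ k ∈ Finset.range j, (Y (i + k) - X (i + k)) = partialDiff X Y (i + j) - partialDiff X Y i := by
  unfold partialDiff; rw [Finset.sum_range_add]; ring

theorem partialDiff_period (hX : ∀ k, X (k + n) = X k) (hY : ∀ k, Y (k + n) = Y k) (i : ℕ) :
    partialDiff X Y (i + n) = partialDiff X Y i + partialDiff X Y n := by
  have h : ∑ k ∈ Finset.range i, (Y (n + k) - X (n + k)) = partialDiff X Y i := by
    refine Finset.sum_congr rfl fun k _ => ?_
    rw [add_comm n k, hX, hY]
  rw [partialDiff_add, add_comm n i] at h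
  linarith

variable [NeZero n]

theorem windowMax_ub (X Y : ℕ → ℤ) {i j : ℕ} (h1 : i ≤ j) (h2 : j < i + n) :
    partialDiff X Y j + Y j ≤ windowMax n X Y i + partialDiff X Y i := by
  obtain ⟨k, rfl⟩ := Nat.exists_eq_add_of_le h1
  have := Finset.le_sup' (fun j => ∑ k ∈ Finset.range j, (Y (i + k) - X (i + k)) + Y (i + j))
    (Finset.mem_range.2 (show k < n by omega))
  simp only [partialDiff_add] at this
  unfold windowMax
  simp only [partialDiff_add]
  linarith

theorem windowMax_att (n : ℕ) [NeZero n] (X Y : ℕ → ℤ) (i : ℕ) : ∃ j, i ≤ j ∧ j < i + n ∧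
    windowMax n X Y i + partialDiff X Y i = partialDiff X Y j + Y j := by
  obtain ⟨j, hj, h⟩ := Finset.exists_mem_eq_sup' (s := Finset.range n)
    ⟨0, Finset.mem_range.2 (NeZero.pos n)⟩
    (fun j => ∑ k ∈ Finset.range j, (Y (i + k) - X (i + k)) + Y (i + j))
  refine ⟨i + j, by omega, by simpa using hj, ?_⟩
  unfold windowMax
  rw [h, partialDiff_add]
  ring

theorem windowMax_period (hX : ∀ k, X (k + n) = X k) (hY : ∀ k, Y (k + n) = Y k) (i : ℕ) :
    windowMax n X Y (i + n) = windowMax n X Y i := by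
  unfold windowMax
  congr 1
  funext j
  have e : ∀ k, i + n + k = i + k + n := fun k => by omega
  simp only [e, hX, hY]

theorem windowMax_nonneg_left (hn : 2 ≤ n) (hX : ∀ k, 0 ≤ X k) (hY : ∀ k, 0 ≤ Y k) (i : ℕ) :
    0 ≤ Y i + windowMax n X Y (i + 1) - windowMax n X Y i := by
  have hs := partialDiff_succ X Y i
  obtain ⟨j, h1, h2, h3⟩ := windowMax_att n X Y i
  rcases h1.eq_or_lt with rfl | h1
  · have := windowMax_ub (n := n) X Y (i := i + 1) (j := i + 1) le_rfl (by omega)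
    have := hX i; have := hY (i + 1)
    linarith
  · have := windowMax_ub (n := n) X Y (i := i + 1) (j := j) h1 (by omega)
    have := hX i
    linarith

theorem windowMax_nonneg_right (hn : 2 ≤ n) (hX : ∀ k, 0 ≤ X k) (hY : ∀ k, 0 ≤ Y k)
    (pY : ∀ k, Y (k + n) = Y k) (i : ℕ) :
    0 ≤ X i + windowMax n X Y i - windowMax n X Y (i + 1) := by
  have hs := partialDiff_succ X Y i
  obtain ⟨j, h1, h2, h3⟩ := windowMax_att n X Y (i + 1)
  by_cases h : j < i + n
  · have := windowMax_ub (n := n) X Y (i := i) (j := j) (by omega) h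
    have := hY i
    linarith
  · obtain rfl : j = i + n := by omega
    have := windowMax_ub (n := n) X Y (i := i) (j := i + n - 1) (by omega) (by omega)
    have h4 := partialDiff_succ X Y (i + n - 1)
    rw [Nat.sub_add_cancel (by omega)] at h4
    have := hX (i + n - 1)
    rw [pY] at h3
    linarith

theorem windowMax_swap (pX : ∀ k, X (k + n) = X k) (pY : ∀ k, Y (k + n) = Y k) {X' Y' : ℕ → ℤ}
    (hX' : ∀ k, X' k = Y k + windowMax n X Y (k + 1) - windowMax n X Y k)
    (hY' : ∀ k, Y' k = X k + windowMax n X Y k - windowMax n X Y (k + 1)) (i : ℕ) :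
    windowMax n X' Y' i = windowMax n X Y i - partialDiff X Y n := by
  set D := partialDiff X Y with hD
  set D' := partialDiff X' Y' with hD'
  set M : ℕ → ℤ := fun k => windowMax n X Y k + D k with hM
  have hDs : ∀ k, D (k + 1) = D k + (Y k - X k) := partialDiff_succ X Y
  have hDn : ∀ k, D (k + n) = D k + D n := partialDiff_period pX pY
  have hMn : ∀ k, M (k + n) = M k + D n := fun k => by
    simp only [hM, windowMax_period pX pY, hDn]; ring
  have ub : ∀ i j, i ≤ j → j < i + n → D j + Y j ≤ M i := fun i j => windowMax_ub X Y
  have att : ∀ i, ∃ j, i ≤ j ∧ j < i + n ∧ M i = D j + Y j := windowMax_att n X Y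
  have hD'k : ∀ k, D' k = D k - 2 * M k + 2 * M 0 := by
    intro k
    induction k with
    | zero => simp [hD, hD', partialDiff]
    | succ k ih =>
      rw [hD', partialDiff_succ, ← hD', ih, hX', hY']
      simp only [hM, hDs]
      ring
  have hG : ∀ k, D' k + Y' k = D k + Y k - M k - M (k + 1) + 2 * M 0 := by
    intro k
    rw [hD'k, hY']
    simp only [hM, hDs]
    ring
  have goal : windowMax n X' Y' i + D' i = 2 * M 0 - M i - D n := by
    apply le_antisymm
    · obtain ⟨j, h1, h2, h3⟩ := windowMax_att n X' Y' i
      rw [← hD', hG] at h3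
      rw [h3]
      -- lower bound `M j + M (j+1) - G j ≥ M i + D n`
      rcases le_total 0 (D n) with hd | hd
      · have mono : Monotone M := by
          refine monotone_nat_of_le_succ fun k => ?_
          obtain ⟨l, a, b, c⟩ := att k
          by_cases hl : l = k
          · subst hl
            have := ub (l + 1) (l + n) (by have := NeZero.pos n; omega) (by omega)
            rw [hDn, pY] at this
            linarith
          · rw [c]; exact ub _ _ (by omega) (by omega)
        have := mono h1
        have h5 := ub (j + 1) (j + n) (by have := NeZero.pos n; omega) (by omega)
        rw [hDn, pY] at h5
        linarith
      · have anti : Antitone M := by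
          refine antitone_nat_of_succ_le fun k => ?_
          obtain ⟨l, a, b, c⟩ := att (k + 1)
          by_cases hl : l = k + n
          · subst hl
            have := ub k k le_rfl (by have := NeZero.pos n; omega)
            rw [hDn, pY] at c
            linarith
          · rw [c]; exact ub _ _ (by omega) (by omega)
        have h4 := anti (show j + 1 ≤ i + n by omega)
        rw [hMn] at h4
        have h5 := ub j j le_rfl (by have := NeZero.pos n; omega)
        linarith
    · -- attained
      have key : ∃ j, i ≤ j ∧ j < i + n ∧ M j + M (j + 1) - (D j + Y j) ≤ M i + D n := by
        obtain ⟨j₀, a0, b0, c0⟩ := att i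
        have stepup : ∀ k, M k < M (k + 1) → M (k + 1) = D k + Y k + D n := by
          intro k hk
          obtain ⟨l, a, b, c⟩ := att (k + 1)
          by_cases hl : l = k + n
          · subst hl; rw [c, hDn, pY]; ring
          · have := ub k l (by omega) (by omega); linarith
        have stepdn : ∀ k, M (k + 1) < M k → M k = D k + Y k := by
          intro k hk
          obtain ⟨l, a, b, c⟩ := att k
          by_cases hl : l = k
          · subst hl; exact c
          · have := ub (k + 1) l (by omega) (by omega); linarith
        rcases lt_trichotomy (D n) 0 with hd | hd | hd
        · -- last index where `M j > M (i + n)`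
          have : ∃ t, t < n ∧ M (i + t) > M (i + n) ∧ M (i + t + 1) ≤ M (i + n) := by
            by_contra hcon
            push Not at hcon
            have : ∀ t, t ≤ n → M (i + t) > M (i + n) := by
              intro t
              induction t with
              | zero => intro _; rw [hMn]; simp; linarith
              | succ t ih => intro ht; exact hcon t (by omega) (ih (by omega))
            exact lt_irrefl _ (this n le_rfl)
          obtain ⟨t, h1, h2, h3⟩ := this
          refine ⟨i + t, by omega, by omega, ?_⟩
          rw [← stepdn (i + t) (by linarith), ← hMn i]
          linarith
        · refine ⟨j₀, a0, b0, ?_⟩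
          have mono : ∀ k, M (k + 1) = M k := by
            intro k
            apply le_antisymm
            · by_contra hk
              have := stepup k (by linarith)
              have := ub k k le_rfl (by have := NeZero.pos n; omega)
              linarith
            · by_contra hk
              have := stepdn k (by linarith)
              have h5 := ub (k + 1) (k + n) (by have := NeZero.pos n; omega) (by omega)
              rw [hDn, pY] at h5
              linarith
          have cst : ∀ k, M k = M 0 := by
            intro k
            induction k with
            | zero => rfl
            | succ k ih => rw [mono, ih]
          rw [← c0, cst (j₀ + 1), cst j₀, cst i, hd]
          linarith
        · have : ∃ t, t < n ∧ M (i + t) ≤ M i ∧ M i < M (i + t + 1) := by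
            by_contra hcon
            push Not at hcon
            have : ∀ t, t ≤ n → M (i + t) ≤ M i := by
              intro t
              induction t with
              | zero => intro _; simp
              | succ t ih => intro ht; exact hcon t (by omega) (ih (by omega))
            have := this n le_rfl
            rw [hMn] at this
            linarith
          obtain ⟨t, h1, h2, h3⟩ := this
          refine ⟨i + t, by omega, by omega, ?_⟩
          rw [stepup (i + t) (by linarith)]
          linarith
      obtain ⟨j, h1, h2, h3⟩ := key
      have := windowMax_ub (n := n) X' Y' h1 h2
      rw [← hD', hG] at this
      linarith
  rw [hD'k] at goal
  simp only [hM] at goal ⊢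
  linarith

end Window

section Rec

/-- Recursive form of a maximum over a window of length `l + 1` starting at `s`. -/
def windowRec (X Y : ℕ → ℤ) : ℕ → ℕ → ℤ
  | s, 0 => Y s
  | s, l + 1 => max (Y s) (Y s - X s + windowRec X Y (s + 1) l)

variable {X Y X' Y' : ℕ → ℤ}

theorem windowRec_snoc (X Y : ℕ → ℤ) (l : ℕ) : ∀ s, windowRec X Y s (l + 1) =
    max (windowRec X Y s l)
      (partialDiff X Y (s + l + 1) - partialDiff X Y s + Y (s + l + 1)) := by
  induction l with
  | zero =>
    intro s
    simp only [windowRec, add_zero, partialDiff_succ]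
    congr 1; ring
  | succ l ih =>
    intro s
    rw [windowRec, ih, windowRec, partialDiff_succ X Y s,
      show s + 1 + l + 1 = s + (l + 1) + 1 by omega]
    omega

theorem partialDiff_le_windowRec (hX : ∀ k, 0 ≤ X k) (l : ℕ) : ∀ s,
    partialDiff X Y (s + l + 1) - partialDiff X Y s ≤ windowRec X Y s l := by
  induction l with
  | zero =>
    intro s
    have := hX s
    simp only [windowRec, add_zero, partialDiff_succ]
    linarith
  | succ l ih =>
    intro s
    have h := ih (s + 1)
    rw [partialDiff_succ X Y s, show s + 1 + l + 1 = s + (l + 1) + 1 by omega] at h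
    rw [windowRec]
    have := le_max_right (Y s) (Y s - X s + windowRec X Y (s + 1) l)
    linarith

theorem windowRec_congr (l : ℕ) : ∀ s, (∀ k, s ≤ k → k ≤ s + l → X k = X' k ∧ Y k = Y' k) →
    windowRec X Y s l = windowRec X' Y' s l := by
  induction l with
  | zero => intro s h; exact (h s le_rfl le_rfl).2
  | succ l ih =>
    intro s h
    rw [windowRec, windowRec, ih (s + 1) fun k h1 h2 => h k (by omega) (by omega),
      (h s le_rfl (by omega)).1, (h s le_rfl (by omega)).2]

theorem partialDiff_congr (l s : ℕ) (h : ∀ k, s ≤ k → k < s + l → X k = X' k ∧ Y k = Y' k) :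
    partialDiff X Y (s + l) - partialDiff X Y s =
      partialDiff X' Y' (s + l) - partialDiff X' Y' s := by
  rw [← partialDiff_add, ← partialDiff_add]
  refine Finset.sum_congr rfl fun k hk => ?_
  have := Finset.mem_range.1 hk
  rw [(h (s + k) (by omega) (by omega)).1, (h (s + k) (by omega) (by omega)).2]

theorem windowRec_block {p : ℕ} (h1 : max (Y p) (Y p - X p + Y (p + 1)) =
      max (Y' p) (Y' p - X' p + Y' (p + 1)))
    (h2 : Y p - X p + (Y (p + 1) - X (p + 1)) = Y' p - X' p + (Y' (p + 1) - X' (p + 1))) (l : ℕ) :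
    ∀ s, s ≤ p → p + 1 ≤ s + l →
      (∀ k, s ≤ k → k ≤ s + l → k ≠ p → k ≠ p + 1 → X k = X' k ∧ Y k = Y' k) →
      windowRec X Y s l = windowRec X' Y' s l := by
  induction l with
  | zero => intro s a b; omega
  | succ l ih =>
    intro s a b h
    rcases a.eq_or_lt with rfl | a
    · rw [windowRec, windowRec]
      cases l with
      | zero => simpa only [windowRec] using h1
      | succ l =>
        rw [windowRec, windowRec, windowRec_congr l (s + 1 + 1)
          fun k h3 h4 => h k (by omega) (by omega) (by omega) (by omega)]
        omega
    · rw [windowRec, windowRec, ih (s + 1) (by omega) (by omega)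
        fun k h3 h4 => h k (by omega) (by omega),
        (h s le_rfl (by omega) (by omega) (by omega)).1,
        (h s le_rfl (by omega) (by omega) (by omega)).2]

theorem windowMax_eq_windowRec (n : ℕ) [NeZero n] (X Y : ℕ → ℤ) (i : ℕ) :
    windowMax n X Y i = windowRec X Y i (n - 1) := by
  have hub : ∀ l s j, s ≤ j → j ≤ s + l →
      partialDiff X Y j + Y j ≤ windowRec X Y s l + partialDiff X Y s := by
    intro l
    induction l with
    | zero => intro s j h1 h2; obtain rfl : j = s := by omega
              rw [windowRec]; linarith
    | succ l ih =>
      intro s j h1 h2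
      rw [windowRec_snoc]
      rcases h2.eq_or_lt with rfl | h2
      · have := le_max_right (windowRec X Y s l)
          (partialDiff X Y (s + l + 1) - partialDiff X Y s + Y (s + l + 1))
        rw [← add_assoc]
        linarith
      · have := ih s j h1 (by omega)
        have := le_max_left (windowRec X Y s l)
          (partialDiff X Y (s + l + 1) - partialDiff X Y s + Y (s + l + 1))
        linarith
  have hatt : ∀ l s, ∃ j, s ≤ j ∧ j ≤ s + l ∧
      windowRec X Y s l + partialDiff X Y s = partialDiff X Y j + Y j := by
    intro l
    induction l with
    | zero => intro s; exact ⟨s, le_rfl, le_rfl, by rw [windowRec]; ring⟩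
    | succ l ih =>
      intro s
      rw [windowRec_snoc]
      rcases max_choice (windowRec X Y s l)
        (partialDiff X Y (s + l + 1) - partialDiff X Y s + Y (s + l + 1)) with h | h
      · obtain ⟨j, h1, h2, h3⟩ := ih s
        exact ⟨j, h1, by omega, by rw [h, h3]⟩
      · exact ⟨s + l + 1, by omega, by omega, by rw [h]; ring⟩
  have hpos := NeZero.pos n
  apply le_antisymm
  · obtain ⟨j, h1, h2, h3⟩ := windowMax_att n X Y i
    have := hub (n - 1) i j h1 (by omega)
    linarith
  · obtain ⟨j, h1, h2, h3⟩ := hatt (n - 1) i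
    have := windowMax_ub (n := n) X Y h1 (by omega)
    linarith

/-- Effect of moving one unit from position `i` to position `i + 1` in `X` or in `Y`. -/
theorem windowMax_move {n : ℕ} [NeZero n] (hn : 2 ≤ n)
    (hX : ∀ k, 0 ≤ X k) (hY : ∀ k, 0 ≤ Y k)
    (pX : ∀ k, X (k + n) = X k) (pY : ∀ k, Y (k + n) = Y k)
    (pX' : ∀ k, X' (k + n) = X' k) (pY' : ∀ k, Y' (k + n) = Y' k) {i : ℕ}
    (hne : ∀ k, i + 2 ≤ k → k < i + n → X' k = X k ∧ Y' k = Y k) :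
    (Y (i + 1) < X i → X' i = X i - 1 → X' (i + 1) = X (i + 1) + 1 → Y' i = Y i →
      Y' (i + 1) = Y (i + 1) →
      (∀ s, i + 2 ≤ s → s ≤ i + n → windowMax n X' Y' s = windowMax n X Y s) ∧
      windowMax n X' Y' (i + 1) = windowMax n X Y (i + 1) -
        if X (i + 1) + windowMax n X Y i < Y i + windowMax n X Y (i + 2) then 1 else 0) ∧
    (X i ≤ Y (i + 1) → 0 < Y i → Y' i = Y i - 1 → Y' (i + 1) = Y (i + 1) + 1 → X' i = X i →
      X' (i + 1) = X (i + 1) →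
      (∀ s, i + 2 ≤ s → s ≤ i + n → windowMax n X' Y' s = windowMax n X Y s) ∧
      windowMax n X' Y' (i + 1) = windowMax n X Y (i + 1) + 1 -
        if X (i + 1) + windowMax n X Y i < Y i + windowMax n X Y (i + 2) then 1 else 0) ∧
    (X i ≤ Y (i + 1) → Y i = 0 →
      ¬ (X (i + 1) + windowMax n X Y i < Y i + windowMax n X Y (i + 2)) ∧
      X i + windowMax n X Y i = windowMax n X Y (i + 1)) := by
  have hXi := hX i; have hXi1 := hX (i + 1); have hYi := hY i; have hYi1 := hY (i + 1)
  have e1 : i + n + 1 = i + 1 + n := by omega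
  have other : max (Y i) (Y i - X i + Y (i + 1)) = max (Y' i) (Y' i - X' i + Y' (i + 1)) →
      Y i - X i + (Y (i + 1) - X (i + 1)) = Y' i - X' i + (Y' (i + 1) - X' (i + 1)) →
      ∀ s, i + 2 ≤ s → s ≤ i + n → windowMax n X' Y' s = windowMax n X Y s := by
    intro h1 h2 s h3 h4
    rw [windowMax_eq_windowRec, windowMax_eq_windowRec]
    refine (windowRec_block (p := i + n) ?_ ?_ (n - 1) s h4 (by omega) ?_).symm
    · rw [e1, pX, pY, pY, pX', pY', pY']; exact h1
    · rw [e1, pX, pY, pY, pX, pX', pY', pY', pX']; exact h2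
    · intro k h5 h6 h7 h8
      rcases lt_or_ge k (i + n) with h | h
      · exact ⟨(hne k (by omega) h).1.symm, (hne k (by omega) h).2.symm⟩
      · obtain ⟨t, rfl⟩ : ∃ t, k = t + n := ⟨k - n, by omega⟩
        rw [pX, pY, pX', pY']
        exact ⟨(hne t (by omega) (by omega)).1.symm, (hne t (by omega) (by omega)).2.symm⟩
  have form : ∃ W S : ℤ, S ≤ W ∧
      ∀ A B : ℕ → ℤ, (∀ k, A (k + n) = A k) → (∀ k, B (k + n) = B k) →
        0 ≤ A i → 0 ≤ B i → 0 ≤ A (i + 1) → 0 ≤ B (i + 1) →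
        (∀ k, i + 2 ≤ k → k < i + n → A k = X k ∧ B k = Y k) →
        (windowMax n A B i = max (B i) (max (B i - A i + B (i + 1))
          (B i - A i + B (i + 1) - A (i + 1) + W)) ∧
        windowMax n A B (i + 1) = max (B (i + 1)) (max (B (i + 1) - A (i + 1) + W)
          (B (i + 1) - A (i + 1) + S + B i)) ∧
        windowMax n A B (i + 2) = max W (max (S + B i) (S + B i - A i + B (i + 1)))) := by
    rcases hn.eq_or_lt with rfl | hn
    · refine ⟨0, 0, le_rfl, fun A B pA pB h1 h2 h3 h4 _ => ?_⟩
      simp only [windowMax_eq_windowRec]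
      have a1 : A (i + 1 + 1) = A i := pA i
      have a2 : B (i + 1 + 1) = B i := pB i
      have a3 : A (i + 2) = A i := pA i
      have a4 : B (i + 2) = B i := pB i
      have a5 : B (i + 2 + 1) = B (i + 1) := pB (i + 1)
      simp only [windowRec, a1, a2, a5]
      omega
    · obtain ⟨k, rfl⟩ : ∃ k, n = k + 3 := ⟨n - 3, by omega⟩
      refine ⟨windowRec X Y (i + 2) k, partialDiff X Y (i + 2 + k + 1) - partialDiff X Y (i + 2),
        partialDiff_le_windowRec hX k (i + 2), fun A B pA pB h1 h2 h3 h4 h => ?_⟩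
      have c1 := windowRec_congr k (i + 2) fun t b1 b2 => h t b1 (by omega)
      have c2 := partialDiff_congr (k + 1) (i + 2) fun t b1 b2 => h t b1 (by omega)
      have a2 : B (i + 2 + k + 1) = B i := by rw [← pB i]; congr 1; omega
      have a3 : A (i + 2 + k + 1) = A i := by rw [← pA i]; congr 1; omega
      have a5 : B (i + 2 + (k + 1) + 1) = B (i + 1) := by rw [← pB (i + 1)]; congr 1; omega
      simp only [windowMax_eq_windowRec, show k + 3 - 1 = k + 2 by omega]
      have u1 : windowRec A B (i + 2) (k + 1) = _ := windowRec_snoc A B k (i + 2)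
      have u2 : windowRec A B (i + 2) (k + 2) = _ := windowRec_snoc A B (k + 1) (i + 2)
      have u3 := partialDiff_succ A B (i + 2 + (k + 1))
      have u4 : windowRec A B (i + 1) (k + 2) = max (B (i + 1))
        (B (i + 1) - A (i + 1) + windowRec A B (i + 2) (k + 1)) := rfl
      have u5 : windowRec A B i (k + 2) = max (B i)
        (B i - A i + max (B (i + 1)) (B (i + 1) - A (i + 1) + windowRec A B (i + 2) k)) := rfl
      have e2 : i + 2 + (k + 1) = i + 2 + k + 1 := by omega
      rw [u4, u5, u2, u1]
      rw [e2] at u3 c2 a5 ⊢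
      rw [a2, a3] at u3
      rw [a2, a5, u3, ← c1, ← c2]
      refine ⟨?_, ?_, ?_⟩ <;> omega
  obtain ⟨W, S, hSW, form⟩ := form
  obtain ⟨f0, f1, f2⟩ := form X Y pX pY hXi hYi hXi1 hYi1 fun k _ _ => ⟨rfl, rfl⟩
  refine ⟨fun h0 h1 h2 h3 h4 => ⟨other ?_ ?_, ?_⟩, fun h0 h5 h1 h2 h3 h4 => ⟨other ?_ ?_, ?_⟩,
    fun h0 h1 => ?_⟩
  · omega
  · omega
  · obtain ⟨g0, g1, g2⟩ := form X' Y' pX' pY' (by omega) (by omega) (by omega) (by omega) hne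
    rw [g1, f0, f1, f2]
    split_ifs <;> omega
  · omega
  · omega
  · obtain ⟨g0, g1, g2⟩ := form X' Y' pX' pY' (by omega) (by omega) (by omega) (by omega) hne
    rw [g1, f0, f1, f2]
    split_ifs <;> omega
  · rw [f0, f1, f2]
    constructor <;> omega

end Rec

/-! ### Crystals of type `sl_n`

The letters `1, …, n` are represented by `Fin n`: the letter `k` is the element of value `k - 1`.
The index set `I = {1, …, n - 1}` is represented in the same way by `Fin (n - 1)`. -/

/-- The letter `i` for an index `i ∈ I`. -/
def lo {n : ℕ} (i : Fin (n - 1)) : Fin n := ⟨i.val, by omega⟩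

/-- The letter `i + 1` for an index `i ∈ I`. -/
def hi {n : ℕ} (i : Fin (n - 1)) : Fin n := ⟨i.val + 1, by omega⟩

theorem lo_ne_hi {n : ℕ} (i : Fin (n - 1)) : lo i ≠ hi i := by
  simp [lo, hi]

/-- The crystal data `f̃_i, ε_i, φ_i`; the value `none` of `f i` stands for the element `0`. -/
class Crystal (n : ℕ) (B : Type) where
  f : Fin (n - 1) → B → Option B
  eps : Fin (n - 1) → B → ℕ
  phi : Fin (n - 1) → B → ℕ

/-- The tensor product rule for crystals, on the product set. -/
instance tensorCrystal (n : ℕ) (B C : Type) [Crystal n B] [Crystal n C] : Crystal n (B × C) where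
  f i b :=
    if Crystal.eps i b.2 < Crystal.phi i b.1 then (Crystal.f i b.1).map fun a => (a, b.2)
    else (Crystal.f i b.2).map fun a => (b.1, a)
  eps i b := max (Crystal.eps i b.1) (Crystal.eps i b.1 + Crystal.eps i b.2 - Crystal.phi i b.1)
  phi i b := max (Crystal.phi i b.2) (Crystal.phi i b.1 + Crystal.phi i b.2 - Crystal.eps i b.2)

theorem tensor_f {n : ℕ} {B C : Type} [Crystal n B] [Crystal n C] (i : Fin (n - 1)) (b : B × C) :
    Crystal.f i b = if Crystal.eps i b.2 < Crystal.phi i b.1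
      then (Crystal.f i b.1).map fun a => (a, b.2)
      else (Crystal.f i b.2).map fun a => (b.1, a) := rfl

/-- Isomorphisms of `sl_n` crystals: bijections commuting with all `f̃_i`. -/
structure CrystalIso (n : ℕ) (B C : Type) [Crystal n B] [Crystal n C] extends B ≃ C where
  map_f : ∀ (i : Fin (n - 1)) (b : B), (Crystal.f i b).map toFun = Crystal.f i (toFun b)

/-- The set `B_ℓ` of one-row semistandard tableaux of width `ℓ`; a tableau is recorded by the
number `count k` of letters `k` in it. -/
@[ext]
structure Row (n ℓ : ℕ) where
  count : Fin n → ℕ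
  sum_count : ∑ k, count k = ℓ

/-- The set `B_♮` of one-column tableaux of height two, with entries `top < bot`. -/
@[ext]
structure Column (n : ℕ) where
  top : Fin n
  bot : Fin n
  top_lt_bot : top < bot

namespace Row

variable {n ℓ : ℕ}

/-- Replace one letter `i` by `i + 1`. -/
def move (i : Fin (n - 1)) (x : Row n ℓ) (h : 0 < x.count (lo i)) : Row n ℓ where
  count k := if k = lo i then x.count k - 1 else if k = hi i then x.count k + 1 else x.count k
  sum_count := by
    have key : ∑ k, ((if k = lo i then x.count k - 1 else if k = hi i then x.count k + 1
        else x.count k) + if k = lo i then 1 else 0) =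
        ∑ k, (x.count k + if k = hi i then 1 else 0) := by
      refine Finset.sum_congr rfl fun k _ => ?_
      have := lo_ne_hi i
      split_ifs <;> simp_all
      omega
    rw [Finset.sum_add_distrib, Finset.sum_add_distrib, x.sum_count] at key
    simpa using key

theorem move_lo (i : Fin (n - 1)) (x : Row n ℓ) (h : 0 < x.count (lo i)) :
    (x.move i h).count (lo i) = x.count (lo i) - 1 := by simp [move]

theorem move_hi (i : Fin (n - 1)) (x : Row n ℓ) (h : 0 < x.count (lo i)) :
    (x.move i h).count (hi i) = x.count (hi i) + 1 := by simp [move, (lo_ne_hi i).symm]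

theorem move_of_ne (i : Fin (n - 1)) (x : Row n ℓ) (h : 0 < x.count (lo i)) {k : Fin n}
    (h1 : k ≠ lo i) (h2 : k ≠ hi i) : (x.move i h).count k = x.count k := by simp [move, h1, h2]

instance crystal (n ℓ : ℕ) : Crystal n (Row n ℓ) where
  f i x := if h : 0 < x.count (lo i) then some (x.move i h) else none
  eps i x := x.count (hi i)
  phi i x := x.count (lo i)

theorem f_def (i : Fin (n - 1)) (x : Row n ℓ) :
    Crystal.f i x = if h : 0 < x.count (lo i) then some (x.move i h) else none := rfl

theorem eps_def (i : Fin (n - 1)) (x : Row n ℓ) : Crystal.eps i x = x.count (hi i) := rfl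

theorem phi_def (i : Fin (n - 1)) (x : Row n ℓ) : Crystal.phi i x = x.count (lo i) := rfl

instance finite (n ℓ : ℕ) : Finite (Row n ℓ) := by
  have hle : ∀ (x : Row n ℓ) k, x.count k < ℓ + 1 := fun x k => by
    have := Finset.single_le_sum (f := x.count) (fun _ _ => Nat.zero_le _) (Finset.mem_univ k)
    rw [x.sum_count] at this
    omega
  refine Finite.of_injective (fun (x : Row n ℓ) (k : Fin n) => (⟨x.count k, hle x k⟩ : Fin (ℓ + 1)))
    fun x y h => Row.ext (funext fun k => ?_)
  simpa using congrFun h k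

theorem exists_pos (x : Row n ℓ) (h : ℓ ≠ 0) : ∃ k, 0 < x.count k := by
  by_contra hcon
  push Not at hcon
  exact h (by rw [← x.sum_count]; exact Finset.sum_eq_zero fun k _ => by have := hcon k; omega)

theorem eq_zero_of (x : Row n ℓ) (h : ∀ k, x.count k = 0) : ℓ = 0 := by
  rw [← x.sum_count]; exact Finset.sum_eq_zero fun k _ => h k

end Row

namespace Column

variable {n : ℕ}

instance membership : Membership (Fin n) (Column n) where
  mem b k := k = b.top ∨ k = b.bot

theorem mem_def (b : Column n) (k : Fin n) : k ∈ b ↔ k = b.top ∨ k = b.bot := Iff.rfl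

instance decidableMem (b : Column n) (k : Fin n) : Decidable (k ∈ b) :=
  inferInstanceAs (Decidable (k = b.top ∨ k = b.bot))

theorem ext_mem {b c : Column n} (h : ∀ k, k ∈ b ↔ k ∈ c) : b = c := by
  have h1 := (h b.top).1 (Or.inl rfl)
  have h2 := (h b.bot).1 (Or.inr rfl)
  have h3 := (h c.top).2 (Or.inl rfl)
  have h4 := (h c.bot).2 (Or.inr rfl)
  have h5 := b.top_lt_bot
  have h6 := c.top_lt_bot
  rw [mem_def] at h1 h2 h3 h4
  apply Column.ext <;> omega

/-- Replace the letter `i` by `i + 1`. -/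
def move (i : Fin (n - 1)) (b : Column n) (h : lo i ∈ b ∧ hi i ∉ b) : Column n where
  top := if b.top = lo i then hi i else b.top
  bot := if b.bot = lo i then hi i else b.bot
  top_lt_bot := by
    obtain ⟨h1, h2⟩ := h
    have h3 := b.top_lt_bot
    simp only [mem_def, lo, hi, Fin.ext_iff, Fin.lt_def] at *
    split_ifs <;> simp <;> omega

theorem mem_move (i : Fin (n - 1)) (b : Column n) (h : lo i ∈ b ∧ hi i ∉ b) (k : Fin n) :
    k ∈ b.move i h ↔ k = hi i ∨ (k ∈ b ∧ k ≠ lo i) := by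
  obtain ⟨h1, h2⟩ := h
  have h3 := b.top_lt_bot
  rw [mem_def] at h1 h2
  simp only [mem_def, move]
  split_ifs <;> grind

instance crystal (n : ℕ) : Crystal n (Column n) where
  f i b := if h : lo i ∈ b ∧ hi i ∉ b then some (b.move i h) else none
  eps i b := if hi i ∈ b ∧ lo i ∉ b then 1 else 0
  phi i b := if lo i ∈ b ∧ hi i ∉ b then 1 else 0

theorem f_def (i : Fin (n - 1)) (b : Column n) :
    Crystal.f i b = if h : lo i ∈ b ∧ hi i ∉ b then some (b.move i h) else none := rfl

theorem eps_def (i : Fin (n - 1)) (b : Column n) :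
    Crystal.eps i b = if hi i ∈ b ∧ lo i ∉ b then 1 else 0 := rfl

theorem phi_def (i : Fin (n - 1)) (b : Column n) :
    Crystal.phi i b = if lo i ∈ b ∧ hi i ∉ b then 1 else 0 := rfl

instance finite (n : ℕ) : Finite (Column n) :=
  Finite.of_injective (fun b : Column n => (b.top, b.bot)) fun b c h => by
    simp only [Prod.mk.injEq] at h
    exact Column.ext h.1 h.2

end Column

/-! ### The isomorphism `B_ℓ ⊗ B_m ≃ B_m ⊗ B_ℓ` -/

section RowRow

variable {n : ℕ} [n.AtLeastTwo] {ℓ m : ℕ}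

/-- The content of a row with indices read modulo `n`. -/
def Row.cyc (x : Row n ℓ) (k : ℕ) : ℤ := x.count (Fin.ofNat n k)

theorem Row.cyc_val (x : Row n ℓ) (k : Fin n) : x.cyc k.val = x.count k := by
  simp [Row.cyc]

theorem Row.cyc_period (x : Row n ℓ) (k : ℕ) : x.cyc (k + n) = x.cyc k := by
  simp [Row.cyc, Fin.ofNat]

theorem Row.cyc_nonneg (x : Row n ℓ) (k : ℕ) : 0 ≤ x.cyc k := Int.natCast_nonneg _

/-- `P_i = max_{0 ≤ j < n} (∑_{k < j} (y_{i+k} - x_{i+k}) + y_{i+j})`, indices modulo `n`. -/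
def rowP (x : Row n ℓ) (y : Row n m) (i : ℕ) : ℤ := windowMax n x.cyc y.cyc i

theorem rowP_left_nonneg (x : Row n ℓ) (y : Row n m) (k : Fin n) :
    0 ≤ (y.count k : ℤ) + rowP x y (k.val + 1) - rowP x y k.val := by
  rw [← Row.cyc_val]
  exact windowMax_nonneg_left Nat.AtLeastTwo.prop x.cyc_nonneg y.cyc_nonneg _

theorem rowP_right_nonneg (x : Row n ℓ) (y : Row n m) (k : Fin n) :
    0 ≤ (x.count k : ℤ) + rowP x y k.val - rowP x y (k.val + 1) := by
  rw [← Row.cyc_val]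
  exact windowMax_nonneg_right Nat.AtLeastTwo.prop x.cyc_nonneg y.cyc_nonneg y.cyc_period _

theorem rowP_sum (x : Row n ℓ) (y : Row n m) :
    ∑ k : Fin n, (rowP x y (k.val + 1) - rowP x y k.val) = 0 := by
  rw [Fin.sum_univ_eq_sum_range (fun k => rowP x y (k + 1) - rowP x y k) n, Finset.sum_range_sub]
  have := windowMax_period (n := n) x.cyc_period y.cyc_period 0
  rw [zero_add] at this
  unfold rowP
  rw [this, sub_self]

/-- The piecewise linear map `(x, y) ↦ (x', y')`, `x'_i = y_i + P_{i+1} - P_i`,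
`y'_i = x_i + P_i - P_{i+1}` (both are nonnegative, so `Int.toNat` loses nothing). -/
def rowRowMap (b : Row n ℓ × Row n m) : Row n m × Row n ℓ :=
  (⟨fun k => ((b.2.count k : ℤ) + rowP b.1 b.2 (k.val + 1) - rowP b.1 b.2 k.val).toNat, by
      zify
      rw [Finset.sum_congr rfl fun k _ => Int.toNat_of_nonneg (rowP_left_nonneg b.1 b.2 k)]
      simp only [add_sub_assoc]
      rw [Finset.sum_add_distrib, rowP_sum, add_zero]
      exact_mod_cast b.2.sum_count⟩,
   ⟨fun k => ((b.1.count k : ℤ) + rowP b.1 b.2 k.val - rowP b.1 b.2 (k.val + 1)).toNat, by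
      zify
      rw [Finset.sum_congr rfl fun k _ => Int.toNat_of_nonneg (rowP_right_nonneg b.1 b.2 k)]
      simp only [add_sub_assoc, ← neg_sub (rowP b.1 b.2 (_ + 1)) (rowP b.1 b.2 _)]
      rw [Finset.sum_add_distrib, Finset.sum_neg_distrib, rowP_sum, neg_zero, add_zero]
      exact_mod_cast b.1.sum_count⟩)

theorem rowRowMap_fst (x : Row n ℓ) (y : Row n m) (k : Fin n) :
    ((rowRowMap (x, y)).1.count k : ℤ) = y.count k + rowP x y (k.val + 1) - rowP x y k.val :=
  Int.toNat_of_nonneg (rowP_left_nonneg x y k)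

theorem rowRowMap_snd (x : Row n ℓ) (y : Row n m) (k : Fin n) :
    ((rowRowMap (x, y)).2.count k : ℤ) = x.count k + rowP x y k.val - rowP x y (k.val + 1) :=
  Int.toNat_of_nonneg (rowP_right_nonneg x y k)

theorem rowP_mod (x : Row n ℓ) (y : Row n m) (k j : ℕ) :
    rowP x y ((Fin.ofNat n k).val + j) = rowP x y (k + j) := by
  have h : ∀ t a, rowP x y (a + n * t) = rowP x y a := by
    intro t
    induction t with
    | zero => simp
    | succ t ih =>
      intro a
      rw [Nat.mul_succ, ← add_assoc, ← ih a]
      exact windowMax_period (n := n) x.cyc_period y.cyc_period _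
  have e : k + j = (k % n + j) + n * (k / n) := by have := Nat.mod_add_div k n; omega
  rw [e, h]
  rfl

theorem rowRowMap_rowRowMap (b : Row n ℓ × Row n m) : rowRowMap (rowRowMap b) = b := by
  obtain ⟨x, y⟩ := b
  have key : ∀ i, rowP (rowRowMap (x, y)).1 (rowRowMap (x, y)).2 i =
      rowP x y i - partialDiff x.cyc y.cyc n := by
    refine windowMax_swap x.cyc_period y.cyc_period (fun k => ?_) fun k => ?_
    · have h0 := rowP_mod x y k 0
      have h1 := rowP_mod x y k 1
      simp only [add_zero] at h0
      rw [Row.cyc, rowRowMap_fst, h0, h1]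
      rfl
    · have h0 := rowP_mod x y k 0
      have h1 := rowP_mod x y k 1
      simp only [add_zero] at h0
      rw [Row.cyc, rowRowMap_snd, h0, h1]
      rfl
  refine Prod.ext (Row.ext (funext fun k => ?_)) (Row.ext (funext fun k => ?_))
  · zify
    rw [rowRowMap_fst, key, key, rowRowMap_snd]
    ring
  · zify
    rw [rowRowMap_snd, key, key, rowRowMap_fst]
    ring

theorem rowRowMap_map_f (i : Fin (n - 1)) (b : Row n ℓ × Row n m) :
    (Crystal.f i b).map rowRowMap = Crystal.f i (rowRowMap b) := by
  obtain ⟨x, y⟩ := b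
  have hn : 2 ≤ n := Nat.AtLeastTwo.prop
  have hi2 := i.isLt
  have clo : ∀ {q : ℕ} (z : Row n q), z.cyc i.val = z.count (lo i) := fun z => Row.cyc_val z (lo i)
  have chi : ∀ {q : ℕ} (z : Row n q), z.cyc (i.val + 1) = z.count (hi i) :=
    fun z => Row.cyc_val z (hi i)
  have cne : ∀ {q : ℕ} (z : Row n q) (h : 0 < z.count (lo i)) (k : ℕ), i.val + 2 ≤ k →
      k < i.val + n → (z.move i h).cyc k = z.cyc k := by
    intro q z h k h1 h2
    have hk : k % n ≠ i.val ∧ k % n ≠ i.val + 1 := by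
      rcases lt_or_ge k n with h3 | h3
      · rw [Nat.mod_eq_of_lt h3]; omega
      · rw [Nat.mod_eq_sub_mod h3, Nat.mod_eq_of_lt (by omega)]; omega
    rw [Row.cyc, Row.move_of_ne]
    · rfl
    · intro h4; exact hk.1 (congrArg Fin.val h4)
    · intro h4; exact hk.2 (congrArg Fin.val h4)
  have full : ∀ {x' : Row n ℓ} {y' : Row n m},
      (∀ s, i.val + 2 ≤ s → s ≤ i.val + n → windowMax n x'.cyc y'.cyc s =
        windowMax n x.cyc y.cyc s) →
      ∀ s, s ≤ n → s ≠ i.val + 1 → rowP x' y' s = rowP x y s := by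
    intro x' y' h s h1 h2
    rcases lt_or_ge s (i.val + 2) with h3 | h3
    · have e1 := windowMax_period (n := n) x'.cyc_period y'.cyc_period s
      have e2 := windowMax_period (n := n) x.cyc_period y.cyc_period s
      unfold rowP
      rw [← e1, ← e2]
      exact h _ (by omega) (by omega)
    · exact h s h3 (by omega)
  have l1 := rowRowMap_fst x y (lo i)
  have l2 := rowRowMap_snd x y (hi i)
  have l3 := rowRowMap_snd x y (lo i)
  have vlo : (lo i).val = i.val := rfl
  have vhi : (hi i).val = i.val + 1 := rfl
  rw [vlo] at l1 l3
  rw [vhi] at l2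
  have key := fun X' Y' => windowMax_move (X := x.cyc) (Y := y.cyc) (X' := X') (Y' := Y') hn
    x.cyc_nonneg y.cyc_nonneg x.cyc_period y.cyc_period (i := i.val)
  have assemble : ∀ (x' : Row n ℓ) (y' : Row n m) (δ : ℤ),
      (∀ s, s ≤ n → s ≠ i.val + 1 → rowP x' y' s = rowP x y s) →
      rowP x' y' (i.val + 1) = rowP x y (i.val + 1) + δ →
      (∀ k, k ≠ lo i → k ≠ hi i → x'.count k = x.count k ∧ y'.count k = y.count k) →
      (y'.count (lo i) + δ + if (rowRowMap (x, y)).2.count (hi i) < (rowRowMap (x, y)).1.count (lo i)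
        then 1 else 0 : ℤ) = y.count (lo i) →
      (y'.count (hi i) - δ - if (rowRowMap (x, y)).2.count (hi i) < (rowRowMap (x, y)).1.count (lo i)
        then 1 else 0 : ℤ) = y.count (hi i) →
      (x'.count (lo i) - δ + if (rowRowMap (x, y)).2.count (hi i) < (rowRowMap (x, y)).1.count (lo i)
        then 0 else 1 : ℤ) = x.count (lo i) →
      (x'.count (hi i) + δ - if (rowRowMap (x, y)).2.count (hi i) < (rowRowMap (x, y)).1.count (lo i)
        then 0 else 1 : ℤ) = x.count (hi i) →
      some (rowRowMap (x', y')) = Crystal.f i (rowRowMap (x, y)) := by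
    intro x' y' δ hP hP1 hne h1 h2 h3 h4
    have a1 := rowRowMap_fst x' y'
    have a2 := rowRowMap_snd x' y'
    have b1 := rowRowMap_fst x y
    have b2 := rowRowMap_snd x y
    have p0 := hP i.val (by omega) (by omega)
    have p2 := hP (i.val + 1 + 1) (by omega) (by omega)
    have a1lo := a1 (lo i); have a1hi := a1 (hi i); have a2lo := a2 (lo i); have a2hi := a2 (hi i)
    have b1lo := b1 (lo i); have b1hi := b1 (hi i); have b2lo := b2 (lo i); have b2hi := b2 (hi i)
    simp only [vlo, vhi] at a1lo a1hi a2lo a2hi b1lo b1hi b2lo b2hi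
    have oth : ∀ k, k ≠ lo i → k ≠ hi i →
        (rowRowMap (x', y')).1.count k = (rowRowMap (x, y)).1.count k ∧
        (rowRowMap (x', y')).2.count k = (rowRowMap (x, y)).2.count k := by
      intro k k1 k2
      have k1' : k.val ≠ i.val := fun h => k1 (Fin.ext h)
      have k2' : k.val ≠ i.val + 1 := fun h => k2 (Fin.ext h)
      have q1 := hP k.val (by omega) k2'
      have q2 := hP (k.val + 1) (by omega) (by omega)
      have := a1 k; have := a2 k; have := b1 k; have := b2 k
      have := hne k k1 k2
      omega
    by_cases hc : (rowRowMap (x, y)).2.count (hi i) < (rowRowMap (x, y)).1.count (lo i)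
    · simp only [if_pos hc] at h1 h2 h3 h4
      have hpos : 0 < (rowRowMap (x, y)).1.count (lo i) := by omega
      have : Crystal.f i (rowRowMap (x, y)) =
          some ((rowRowMap (x, y)).1.move i hpos, (rowRowMap (x, y)).2) := by
        simp only [tensor_f, Row.f_def, Row.eps_def, Row.phi_def, if_pos hc, dif_pos hpos, Option.map_some]
      rw [this]
      refine congrArg some (Prod.ext (Row.ext (funext fun k => ?_)) (Row.ext (funext fun k => ?_)))
      · by_cases k1 : k = lo i
        · subst k1; rw [Row.move_lo]; omega
        · by_cases k2 : k = hi i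
          · subst k2; rw [Row.move_hi]; omega
          · rw [Row.move_of_ne i _ _ k1 k2]; exact (oth k k1 k2).1
      · by_cases k1 : k = lo i
        · subst k1; simp only; omega
        · by_cases k2 : k = hi i
          · subst k2; simp only; omega
          · exact (oth k k1 k2).2
    · simp only [if_neg hc] at h1 h2 h3 h4
      have hpos : 0 < (rowRowMap (x, y)).2.count (lo i) := by omega
      have : Crystal.f i (rowRowMap (x, y)) =
          some ((rowRowMap (x, y)).1, (rowRowMap (x, y)).2.move i hpos) := by
        simp only [tensor_f, Row.f_def, Row.eps_def, Row.phi_def, if_neg hc, dif_pos hpos, Option.map_some]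
      rw [this]
      refine congrArg some (Prod.ext (Row.ext (funext fun k => ?_)) (Row.ext (funext fun k => ?_)))
      · by_cases k1 : k = lo i
        · subst k1; simp only; omega
        · by_cases k2 : k = hi i
          · subst k2; simp only; omega
          · exact (oth k k1 k2).1
      · by_cases k1 : k = lo i
        · subst k1; rw [Row.move_lo]; omega
        · by_cases k2 : k = hi i
          · subst k2; rw [Row.move_hi]; omega
          · rw [Row.move_of_ne i _ _ k1 k2]; exact (oth k k1 k2).2
  have hcond : (x.cyc (i.val + 1) + windowMax n x.cyc y.cyc i.val <
      y.cyc i.val + windowMax n x.cyc y.cyc (i.val + 2)) ↔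
      (rowRowMap (x, y)).2.count (hi i) < (rowRowMap (x, y)).1.count (lo i) := by
    rw [clo, chi]
    unfold rowP at l1 l2
    rw [show i.val + 1 + 1 = i.val + 2 from rfl] at l2
    omega
  by_cases hc : y.count (hi i) < x.count (lo i)
  · have hpos : 0 < x.count (lo i) := by omega
    have : Crystal.f i (x, y) = some (x.move i hpos, y) := by
      simp only [tensor_f, Row.f_def, Row.eps_def, Row.phi_def, if_pos hc, dif_pos hpos, Option.map_some]
    rw [this, Option.map_some]
    have mlo := Row.move_lo i x hpos
    have mhi := Row.move_hi i x hpos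
    obtain ⟨g1, g2⟩ := (key (x.move i hpos).cyc y.cyc (x.move i hpos).cyc_period y.cyc_period
      fun k h1 h2 => ⟨cne x hpos k h1 h2, rfl⟩).1 (by rw [clo, chi]; omega)
      (by rw [clo, clo]; omega) (by rw [chi, chi]; omega) rfl rfl
    refine assemble _ _ (-if (rowRowMap (x, y)).2.count (hi i) < (rowRowMap (x, y)).1.count (lo i)
      then 1 else 0) (full g1) ?_ (fun k k1 k2 => ⟨Row.move_of_ne i x hpos k1 k2, rfl⟩)
      ?_ ?_ ?_ ?_
    · simp only [hcond] at g2
      exact g2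
    all_goals split_ifs <;> omega
  · by_cases hpos : 0 < y.count (lo i)
    · have : Crystal.f i (x, y) = some (x, y.move i hpos) := by
        simp only [tensor_f, Row.f_def, Row.eps_def, Row.phi_def, if_neg hc, dif_pos hpos, Option.map_some]
      rw [this, Option.map_some]
      have mlo := Row.move_lo i y hpos
      have mhi := Row.move_hi i y hpos
      obtain ⟨g1, g2⟩ := (key x.cyc (y.move i hpos).cyc x.cyc_period (y.move i hpos).cyc_period
        fun k h1 h2 => ⟨rfl, cne y hpos k h1 h2⟩).2.1 (by rw [clo, chi]; omega)
        (by rw [clo]; omega) (by rw [clo, clo]; omega) (by rw [chi, chi]; omega) rfl rfl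
      refine assemble _ _ (1 - if (rowRowMap (x, y)).2.count (hi i) <
        (rowRowMap (x, y)).1.count (lo i) then 1 else 0) (full g1) ?_
        (fun k k1 k2 => ⟨rfl, Row.move_of_ne i y hpos k1 k2⟩) ?_ ?_ ?_ ?_
      · simp only [hcond] at g2
        unfold rowP
        rw [g2]; ring
      all_goals split_ifs <;> omega
    · have : Crystal.f i (x, y) = none := by
        simp only [tensor_f, Row.f_def, Row.eps_def, Row.phi_def, if_neg hc, dif_neg hpos, Option.map_none]
      rw [this, Option.map_none]
      obtain ⟨g1, g2⟩ := (key x.cyc y.cyc x.cyc_period y.cyc_period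
        fun k h1 h2 => ⟨rfl, rfl⟩).2.2 (by rw [clo, chi]; omega) (by rw [clo]; omega)
      rw [hcond] at g1
      rw [clo] at g2
      unfold rowP at l3
      have hz : ¬ 0 < (rowRowMap (x, y)).2.count (lo i) := by omega
      simp only [tensor_f, Row.f_def, Row.eps_def, Row.phi_def, if_neg g1, dif_neg hz, Option.map_none]

/-- The (unique) crystal isomorphism `B_ℓ ⊗ B_m ≃ B_m ⊗ B_ℓ`, given by the piecewise linear map. -/
def rowRowIso (n : ℕ) [n.AtLeastTwo] (ℓ m : ℕ) :
    CrystalIso n (Row n ℓ × Row n m) (Row n m × Row n ℓ) where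
  toFun := rowRowMap
  invFun := rowRowMap
  left_inv := rowRowMap_rowRowMap
  right_inv := rowRowMap_rowRowMap
  map_f := rowRowMap_map_f

end RowRow


/-! ### The isomorphism `B_♮ ⊗ B_ℓ ≃ B_ℓ ⊗ B_♮` -/

section ColumnRow

variable {n ℓ : ℕ}

/-- The letters occurring in a row. -/
def Row.letters (x : Row n ℓ) : Finset (Fin n) :=
  Finset.univ.filter fun k => 0 < x.count k

/-- The letters larger than `a` occurring in a row. -/
def Row.above (x : Row n ℓ) (a : Fin n) : Finset (Fin n) :=
  Finset.univ.filter fun k => a < k ∧ 0 < x.count k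

theorem Row.mem_letters (x : Row n ℓ) (k : Fin n) : k ∈ x.letters ↔ 0 < x.count k := by
  simp [Row.letters]

theorem Row.mem_above (x : Row n ℓ) (a k : Fin n) : k ∈ x.above a ↔ a < k ∧ 0 < x.count k := by
  simp [Row.above]

/-- The column leaving a row `γ₁ ≤ ⋯ ≤ γ_ℓ` that the column with entries `α < β` has entered. Here
`γ₁ = x.letters.min'` is the smallest letter of the row, and `(x.above α).min'`, `(x.above β).min'`
are the smallest letters `γ_i > α`, `γ_j > β` of the row, if there are any:
(I) `γ_ℓ ≤ α`: `γ₁, β`;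
(II) `γ_{i-1} ≤ α < γ_i`, `i ≥ 2`, `γ_ℓ ≤ β`: `γ₁, γ_i`;
(III) `α < γ₁`, `γ_ℓ ≤ β`: `α, γ₁`;
(IV) `γ_{i-1} ≤ α < γ_i`, `γ_{j-1} ≤ β < γ_j`, `i < j`: `γ_i, γ_j`;
(V) `γ_{i-1} ≤ α`, `β < γ_i`: `β, γ_i`.
For the empty row (`ℓ = 0`) the column is unchanged. -/
def outColumn (b : Column n) (x : Row n ℓ) : Column n :=
  if hx : x.letters.Nonempty then
    if ha : (x.above b.top).Nonempty then
      if hb : (x.above b.bot).Nonempty then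
        if hab : (x.above b.top).min' ha ≤ b.bot then
          ⟨(x.above b.top).min' ha, (x.above b.bot).min' hb,
            hab.trans_lt ((x.mem_above _ _).1 (Finset.min'_mem _ hb)).1⟩
        else ⟨b.bot, (x.above b.top).min' ha, not_le.1 hab⟩
      else if h : x.letters.min' hx ≤ b.top then
        ⟨x.letters.min' hx, (x.above b.top).min' ha,
          h.trans_lt ((x.mem_above _ _).1 (Finset.min'_mem _ ha)).1⟩
      else ⟨b.top, x.letters.min' hx, not_le.1 h⟩
    else ⟨x.letters.min' hx, b.bot, by
      refine lt_of_le_of_lt ?_ b.top_lt_bot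
      by_contra h
      exact ha ⟨x.letters.min' hx, (x.mem_above _ _).2
        ⟨not_le.1 h, (x.mem_letters _).1 (Finset.min'_mem _ hx)⟩⟩⟩
  else b

/-- The successor in the cyclic order of the letters. -/
def cycNext (k : Fin n) : Fin n := ⟨(k.val + 1) % n, Nat.mod_lt _ (by have := k.isLt; omega)⟩

theorem cycNext_cases (k : Fin n) : (k.val + 1 < n ∧ (cycNext k).val = k.val + 1) ∨
    (k.val + 1 = n ∧ (cycNext k).val = 0) := by
  have := k.isLt
  unfold cycNext
  rcases lt_or_ge (k.val + 1) n with h | h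
  · left; exact ⟨h, Nat.mod_eq_of_lt h⟩
  · right
    have : k.val + 1 = n := by omega
    exact ⟨this, by simp [this]⟩

/-- `p k` says that a letter of the column is still to be exchanged when the row is read
cyclically and the letter `k` is reached. -/
structure Pending (b : Column n) (x : Row n ℓ) (p : Fin n → Prop) : Prop where
  next : ∀ k, p (cycNext k) ↔ k ∈ b ∨ (p k ∧ x.count k = 0)
  zero : ℓ = 0 → ∀ k, p k

theorem cyc_induction {Q : Fin n → Prop} {k₀ : Fin n} (h0 : Q k₀)
    (h : ∀ k, Q k → Q (cycNext k)) (k : Fin n) : Q k := by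
  have up : ∀ a : Fin n, Q a → ∀ t (ht : a.val + t < n), Q ⟨a.val + t, ht⟩ := by
    intro a ha t
    induction t with
    | zero => intro _; exact ha
    | succ t ih =>
      intro ht
      have := h _ (ih (by omega))
      rcases cycNext_cases (⟨a.val + t, by omega⟩ : Fin n) with ⟨_, h2⟩ | ⟨h1, _⟩
      · convert this using 1
        exact Fin.ext h2.symm
      · simp only at h1; omega
  have hpos := k.isLt
  have hlast := up k₀ h0 (n - 1 - k₀.val) (by omega)
  have hzero : Q ⟨0, by omega⟩ := by
    have := h _ hlast
    rcases cycNext_cases (⟨k₀.val + (n - 1 - k₀.val), by omega⟩ : Fin n) with ⟨h1, _⟩ | ⟨_, h2⟩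
    · simp only at h1; omega
    · convert this using 1
      exact Fin.ext h2.symm
  have := up _ hzero k.val (by simp)
  simpa using this

theorem cyc_induction_back {Q : Fin n → Prop} {k₀ : Fin n} (h0 : Q k₀)
    (h : ∀ k, Q (cycNext k) → Q k) (k : Fin n) : Q k := by
  by_contra hk
  exact cyc_induction (Q := fun k => ¬ Q k) hk (fun k hk h' => hk (h k h')) k₀ h0

theorem Pending.unique {b : Column n} {x : Row n ℓ} {p q : Fin n → Prop} (hp : Pending b x p)
    (hq : Pending b x q) (k : Fin n) : p k ↔ q k := by
  by_cases hℓ : ℓ = 0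
  · simp [hp.zero hℓ k, hq.zero hℓ k]
  · obtain ⟨k₀, hk₀⟩ := x.exists_pos hℓ
    refine cyc_induction (Q := fun k => p k ↔ q k) (k₀ := cycNext k₀) ?_ (fun k hk => ?_) k
    · rw [hp.next, hq.next]; simp [hk₀.ne']
    · rw [hp.next, hq.next, hk]

theorem exists_pending (b : Column n) (x : Row n ℓ) : ∃ p, Pending b x p ∧
    ∀ k, k ∈ outColumn b x ↔ p k ∧ (0 < x.count k ∨ k ∈ b) := by
  have hab := b.top_lt_bot
  by_cases hx : x.letters.Nonempty
  · have hℓ : ℓ = 0 → False := by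
      intro h
      obtain ⟨k, hk⟩ := hx
      have := Finset.single_le_sum (f := x.count) (fun _ _ => Nat.zero_le _) (Finset.mem_univ k)
      rw [x.sum_count] at this
      rw [x.mem_letters] at hk
      omega
    have hm := (x.mem_letters _).1 (Finset.min'_mem _ hx)
    have hm' : ∀ k, 0 < x.count k → x.letters.min' hx ≤ k := fun k hk =>
      Finset.min'_le _ _ ((x.mem_letters k).2 hk)
    by_cases ha : (x.above b.top).Nonempty
    · have hc := (x.mem_above _ _).1 (Finset.min'_mem _ ha)
      have hc' : ∀ k, b.top < k → 0 < x.count k → (x.above b.top).min' ha ≤ k := fun k h1 h2 =>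
        Finset.min'_le _ _ ((x.mem_above _ k).2 ⟨h1, h2⟩)
      by_cases hb : (x.above b.bot).Nonempty
      · have hd := (x.mem_above _ _).1 (Finset.min'_mem _ hb)
        have hd' : ∀ k, b.bot < k → 0 < x.count k → (x.above b.bot).min' hb ≤ k := fun k h1 h2 =>
          Finset.min'_le _ _ ((x.mem_above _ k).2 ⟨h1, h2⟩)
        by_cases hcb : (x.above b.top).min' ha ≤ b.bot
        · have e : (outColumn b x).top = (x.above b.top).min' ha ∧ (outColumn b x).bot = (x.above b.bot).min' hb := by
            rw [outColumn, dif_pos hx, dif_pos ha, dif_pos hb, dif_pos hcb]; exact ⟨rfl, rfl⟩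
          generalize outColumn b x = o at *
          generalize (x.above b.top).min' ha = c at *
          generalize (x.above b.bot).min' hb = d at *
          generalize x.letters.min' hx = m at *
          obtain ⟨e1, e2⟩ := e
          refine ⟨fun k => (b.top < k ∧ k ≤ c) ∨ (b.bot < k ∧ k ≤ d), ⟨fun k => ?_, fun h => (hℓ h).elim⟩, fun k => ?_⟩
          · have := cycNext_cases k
            rw [Column.mem_def]
            have := hc' k
            have := hd' k
            grind
          · simp only [Column.mem_def, e1, e2]
            have := hc' k
            have := hd' k
            grind
        · have e : (outColumn b x).top = b.bot ∧ (outColumn b x).bot = (x.above b.top).min' ha := by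
            rw [outColumn, dif_pos hx, dif_pos ha, dif_pos hb, dif_neg hcb]; exact ⟨rfl, rfl⟩
          generalize outColumn b x = o at *
          generalize (x.above b.top).min' ha = c at *
          generalize (x.above b.bot).min' hb = d at *
          generalize x.letters.min' hx = m at *
          obtain ⟨e1, e2⟩ := e
          refine ⟨fun k => b.top < k ∧ k ≤ c, ⟨fun k => ?_, fun h => (hℓ h).elim⟩, fun k => ?_⟩
          · have := cycNext_cases k
            rw [Column.mem_def]
            have := hc' k
            have := hd' k
            grind
          · simp only [Column.mem_def, e1, e2]
            have := hc' k
            have := hd' k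
            grind
      · have hb' : ∀ k, b.bot < k → x.count k = 0 := fun k h1 => by
          by_contra h2
          exact hb ⟨k, (x.mem_above _ k).2 ⟨h1, Nat.pos_of_ne_zero h2⟩⟩
        by_cases hmt : x.letters.min' hx ≤ b.top
        · have e : (outColumn b x).top = x.letters.min' hx ∧ (outColumn b x).bot = (x.above b.top).min' ha := by
            rw [outColumn, dif_pos hx, dif_pos ha, dif_neg hb, dif_pos hmt]; exact ⟨rfl, rfl⟩
          generalize outColumn b x = o at *
          generalize (x.above b.top).min' ha = c at *
          generalize x.letters.min' hx = m at *
          obtain ⟨e1, e2⟩ := e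
          refine ⟨fun k => (b.top < k ∧ k ≤ c) ∨ b.bot < k ∨ k ≤ m, ⟨fun k => ?_, fun h => (hℓ h).elim⟩, fun k => ?_⟩
          · have := cycNext_cases k
            rw [Column.mem_def]
            have := hc' k
            have := hm' k
            have := hb' k
            grind
          · simp only [Column.mem_def, e1, e2]
            have := hc' k
            have := hm' k
            have := hb' k
            grind
        · have e : (outColumn b x).top = b.top ∧ (outColumn b x).bot = x.letters.min' hx := by
            rw [outColumn, dif_pos hx, dif_pos ha, dif_neg hb, dif_neg hmt]; exact ⟨rfl, rfl⟩
          generalize outColumn b x = o at *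
          generalize (x.above b.top).min' ha = c at *
          generalize x.letters.min' hx = m at *
          obtain ⟨e1, e2⟩ := e
          refine ⟨fun k => b.bot < k ∨ k ≤ m, ⟨fun k => ?_, fun h => (hℓ h).elim⟩, fun k => ?_⟩
          · have := cycNext_cases k
            rw [Column.mem_def]
            have := hc' k
            have := hm' k
            have := hb' k
            grind
          · simp only [Column.mem_def, e1, e2]
            have := hc' k
            have := hm' k
            have := hb' k
            grind
    · have ha' : ∀ k, b.top < k → x.count k = 0 := fun k h1 => by
        by_contra h2
        exact ha ⟨k, (x.mem_above _ k).2 ⟨h1, Nat.pos_of_ne_zero h2⟩⟩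
      have e : (outColumn b x).top = x.letters.min' hx ∧ (outColumn b x).bot = b.bot := by
        rw [outColumn, dif_pos hx, dif_neg ha]; exact ⟨rfl, rfl⟩
      generalize outColumn b x = o at *
      generalize x.letters.min' hx = m at *
      obtain ⟨e1, e2⟩ := e
      refine ⟨fun k => b.top < k ∨ k ≤ m, ⟨fun k => ?_, fun h => (hℓ h).elim⟩, fun k => ?_⟩
      · have := cycNext_cases k
        rw [Column.mem_def]
        have := ha' k
        have := hm' k
        grind
      · simp only [Column.mem_def, e1, e2]
        have := ha' k
        have := hm' k
        grind
  · have h0 : ∀ k, x.count k = 0 := fun k => by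
      by_contra h
      exact hx ⟨k, (x.mem_letters k).2 (Nat.pos_of_ne_zero h)⟩
    rw [outColumn, dif_neg hx]
    exact ⟨fun _ => True, ⟨fun k => by simp [h0], fun _ _ => trivial⟩, fun k => by simp [h0]⟩

theorem Pending.mem_outColumn {b : Column n} {x : Row n ℓ} {p : Fin n → Prop} (hp : Pending b x p)
    (k : Fin n) : k ∈ outColumn b x ↔ p k ∧ (0 < x.count k ∨ k ∈ b) := by
  obtain ⟨q, hq, h⟩ := exists_pending b x
  rw [h, hq.unique hp]

theorem outColumn_le (b : Column n) (x : Row n ℓ) (k : Fin n) :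
    (if k ∈ outColumn b x then 1 else 0) ≤ x.count k + if k ∈ b then 1 else 0 := by
  obtain ⟨p, _, h⟩ := exists_pending b x
  have := h k
  split_ifs <;> simp_all
  omega

theorem Column.sum_mem (b : Column n) : ∑ k, (if k ∈ b then 1 else 0) = 2 := by
  have h : Finset.univ.filter (fun k => k ∈ b) = {b.top, b.bot} := by
    ext k; simp [Column.mem_def]
  rw [← Finset.card_filter, h, Finset.card_pair b.top_lt_bot.ne]

/-- The map `B_♮ ⊗ B_ℓ → B_ℓ ⊗ B_♮`: the column leaving the row is `outColumn`, and the letters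
which remain form the new row. -/
def columnRowMap (b : Column n × Row n ℓ) : Row n ℓ × Column n :=
  (⟨fun k => (b.2.count k + if k ∈ b.1 then 1 else 0) -
      if k ∈ outColumn b.1 b.2 then 1 else 0, by
    have h : ∑ k, ((b.2.count k + (if k ∈ b.1 then 1 else 0) -
        if k ∈ outColumn b.1 b.2 then 1 else 0) + if k ∈ outColumn b.1 b.2 then 1 else 0) =
        ∑ k, (b.2.count k + if k ∈ b.1 then 1 else 0) :=
      Finset.sum_congr rfl fun k _ => Nat.sub_add_cancel (outColumn_le b.1 b.2 k)
    rw [Finset.sum_add_distrib, Finset.sum_add_distrib, Column.sum_mem, Column.sum_mem,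
      b.2.sum_count] at h
    omega⟩, outColumn b.1 b.2)

theorem columnRowMap_count (b : Column n) (x : Row n ℓ) (k : Fin n) :
    (columnRowMap (b, x)).1.count k + (if k ∈ outColumn b x then 1 else 0) =
      x.count k + if k ∈ b then 1 else 0 :=
  Nat.sub_add_cancel (outColumn_le b x k)

theorem columnRowMap_snd (b : Column n) (x : Row n ℓ) : (columnRowMap (b, x)).2 = outColumn b x :=
  rfl

theorem Pending.back {b : Column n} {x : Row n ℓ} {p : Fin n → Prop} (hp : Pending b x p)
    (k : Fin n) : p k ↔ k ∈ outColumn b x ∨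
      (p (cycNext k) ∧ (columnRowMap (b, x)).1.count k = 0) := by
  have h1 := hp.mem_outColumn k
  have h2 := columnRowMap_count b x k
  have h3 := hp.next k
  grind

theorem columnRowMap_injective : Function.Injective (columnRowMap (n := n) (ℓ := ℓ)) := by
  rintro ⟨b, x⟩ ⟨c, y⟩ h
  obtain ⟨p, hp, -⟩ := exists_pending b x
  obtain ⟨q, hq, -⟩ := exists_pending c y
  have h1 : outColumn b x = outColumn c y := congrArg Prod.snd h
  have h2 : (columnRowMap (b, x)).1 = (columnRowMap (c, y)).1 := congrArg Prod.fst h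
  have hpq : ∀ k, p k ↔ q k := by
    by_cases hℓ : ℓ = 0
    · intro k; simp [hp.zero hℓ k, hq.zero hℓ k]
    · obtain ⟨k₀, hk₀⟩ := (columnRowMap (b, x)).1.exists_pos hℓ
      refine fun k => cyc_induction_back (Q := fun k => p k ↔ q k) (k₀ := k₀) ?_
        (fun k hk => ?_) k
      · rw [hp.back, hq.back, ← h1, ← h2]; simp [hk₀.ne']
      · rw [hp.back, hq.back, ← h1, ← h2, hk]
  have key : ∀ k, (k ∈ b ↔ k ∈ c) ∧ x.count k = y.count k := by
    intro k
    have a1 := hp.mem_outColumn k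
    have a2 := hq.mem_outColumn k
    have a3 := columnRowMap_count b x k
    have a4 := columnRowMap_count c y k
    have a5 := hp.next k
    have a6 := hq.next k
    have a7 := hpq k
    have a8 := hpq (cycNext k)
    rw [h1] at a1 a3
    rw [h2] at a3
    grind
  exact Prod.ext (Column.ext_mem fun k => (key k).1) (Row.ext (funext fun k => (key k).2))

theorem columnRowMap_bijective : Function.Bijective (columnRowMap (n := n) (ℓ := ℓ)) :=
  ⟨columnRowMap_injective, (Finite.injective_iff_surjective_of_equiv (Equiv.prodComm _ _)).1
    columnRowMap_injective⟩

theorem cycNext_lo (i : Fin (n - 1)) : cycNext (lo i) = hi i := by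
  have := i.isLt
  exact Fin.ext (Nat.mod_eq_of_lt (show i.val + 1 < n by omega))

theorem cycNext_eq_hi (i : Fin (n - 1)) (k : Fin n) : cycNext k = hi i ↔ k = lo i := by
  refine ⟨fun h => ?_, fun h => h ▸ cycNext_lo i⟩
  have h := congrArg Fin.val h
  simp only [hi] at h
  apply Fin.ext
  simp only [lo]
  rcases cycNext_cases k with ⟨_, h2⟩ | ⟨_, h2⟩ <;> omega

theorem columnRowMap_move (i : Fin (n - 1)) {b b' : Column n} {x x' : Row n ℓ}
    (hb : ∀ k, k ≠ lo i → k ≠ hi i → (k ∈ b' ↔ k ∈ b))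
    (hx : ∀ k, k ≠ lo i → k ≠ hi i → x'.count k = x.count k)
    (hc : (lo i ∈ b ∧ hi i ∉ b ∧ x.count (hi i) = 0 ∧ lo i ∉ b' ∧ hi i ∈ b' ∧
        x'.count (lo i) = x.count (lo i) ∧ x'.count (hi i) = x.count (hi i)) ∨
      (¬ (lo i ∈ b ∧ hi i ∉ b ∧ x.count (hi i) = 0) ∧ (lo i ∈ b' ↔ lo i ∈ b) ∧
        (hi i ∈ b' ↔ hi i ∈ b) ∧ x'.count (lo i) + 1 = x.count (lo i) ∧
        x'.count (hi i) = x.count (hi i) + 1)) :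
    some (columnRowMap (b', x')) = Crystal.f i (columnRowMap (b, x)) := by
  obtain ⟨p, hp, -⟩ := exists_pending b x
  have hne := lo_ne_hi i
  have hnh : cycNext (hi i) ≠ hi i := fun h => hne ((cycNext_eq_hi i _).1 h).symm
  have hp' : Pending b' x' fun k => if k = hi i then lo i ∈ b' ∨ (p (lo i) ∧ x'.count (lo i) = 0)
      else p k := by
    refine ⟨fun k => ?_, fun h k => ?_⟩
    · simp only [cycNext_eq_hi]
      by_cases k1 : k = lo i
      · subst k1; simp [hne]
      · have h1 := hp.next k
        have h2 := hp.next (lo i)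
        rw [cycNext_lo] at h2
        by_cases k2 : k = hi i
        · subst k2
          simp only [if_neg k1, if_true]
          grind
        · simp only [if_neg k1, if_neg k2]
          rw [h1, hb k k1 k2, hx k k1 k2]
    · have := hp.zero h
      have hz : x'.count (lo i) = 0 := by
        have := Finset.single_le_sum (f := x'.count) (fun _ _ => Nat.zero_le _)
          (Finset.mem_univ (lo i))
        rw [x'.sum_count] at this
        omega
      simp [this, hz]
  have hlohi := hp.next (lo i)
  rw [cycNext_lo] at hlohi
  have m1 := hp.mem_outColumn (lo i)
  have m2 := hp.mem_outColumn (hi i)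
  have m3 := hp'.mem_outColumn (lo i)
  have m4 := hp'.mem_outColumn (hi i)
  simp only [if_neg hne, if_true] at m3 m4
  have c1 := columnRowMap_count b x (lo i)
  have c2 := columnRowMap_count b x (hi i)
  have c3 := columnRowMap_count b' x' (lo i)
  have c4 := columnRowMap_count b' x' (hi i)
  have oth : ∀ k, k ≠ lo i → k ≠ hi i → (k ∈ outColumn b' x' ↔ k ∈ outColumn b x) ∧
      (columnRowMap (b', x')).1.count k = (columnRowMap (b, x)).1.count k := by
    intro k k1 k2
    have a1 := hp.mem_outColumn k
    have a2 := hp'.mem_outColumn k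
    have a3 := columnRowMap_count b x k
    have a4 := columnRowMap_count b' x' k
    have a5 := hb k k1 k2
    have a6 := hx k k1 k2
    simp only [if_neg k2] at a2
    simp only [a5, a6] at a2 a4
    have a7 : k ∈ outColumn b' x' ↔ k ∈ outColumn b x := a2.trans a1.symm
    refine ⟨a7, ?_⟩
    simp only [a7] at a4
    omega
  by_cases hcond : Crystal.eps i (outColumn b x) < (columnRowMap (b, x)).1.count (lo i)
  · have hpos : 0 < (columnRowMap (b, x)).1.count (lo i) := by omega
    have : Crystal.f i (columnRowMap (b, x)) =
        some ((columnRowMap (b, x)).1.move i hpos, outColumn b x) := by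
      simp only [tensor_f, columnRowMap_snd, Row.f_def, Row.phi_def, if_pos hcond, dif_pos hpos,
        Option.map_some]
    rw [this]
    rw [Column.eps_def] at hcond
    refine congrArg some (Prod.ext (Row.ext (funext fun k => ?_)) (Column.ext_mem fun k => ?_))
    · by_cases k1 : k = lo i
      · subst k1; rw [Row.move_lo]; grind
      · by_cases k2 : k = hi i
        · subst k2; rw [Row.move_hi]; grind
        · rw [Row.move_of_ne i _ _ k1 k2]; exact (oth k k1 k2).2
    · rw [columnRowMap_snd]
      by_cases k1 : k = lo i
      · subst k1; grind
      · by_cases k2 : k = hi i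
        · subst k2; grind
        · exact (oth k k1 k2).1
  · rw [Column.eps_def] at hcond
    have hmem : lo i ∈ outColumn b x ∧ hi i ∉ outColumn b x := by grind
    have : Crystal.f i (columnRowMap (b, x)) =
        some ((columnRowMap (b, x)).1, (outColumn b x).move i hmem) := by
      simp only [tensor_f, columnRowMap_snd, Column.f_def, Column.eps_def, Row.phi_def,
        if_neg hcond, dif_pos hmem, Option.map_some]
    rw [this]
    refine congrArg some (Prod.ext (Row.ext (funext fun k => ?_)) (Column.ext_mem fun k => ?_))
    · by_cases k1 : k = lo i
      · subst k1; grind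
      · by_cases k2 : k = hi i
        · subst k2; grind
        · exact (oth k k1 k2).2
    · rw [columnRowMap_snd]
      simp only [Column.mem_move]
      by_cases k1 : k = lo i
      · subst k1; grind
      · by_cases k2 : k = hi i
        · subst k2; grind
        · have := (oth k k1 k2).1; grind

theorem columnRowMap_map_f (i : Fin (n - 1)) (b : Column n × Row n ℓ) :
    (Crystal.f i b).map columnRowMap = Crystal.f i (columnRowMap b) := by
  obtain ⟨b, x⟩ := b
  have hne := lo_ne_hi i
  by_cases hc : Crystal.eps i x < Crystal.phi i b
  · have hc' := hc
    rw [Row.eps_def, Column.phi_def] at hc'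
    have hmem : lo i ∈ b ∧ hi i ∉ b := by grind
    have h0 : x.count (hi i) = 0 := by grind
    have : Crystal.f i (b, x) = some (b.move i hmem, x) := by
      simp only [tensor_f, if_pos hc, Column.f_def, dif_pos hmem, Option.map_some]
    rw [this, Option.map_some]
    refine columnRowMap_move i (fun k k1 k2 => ?_) (fun _ _ _ => rfl) (Or.inl ⟨hmem.1, hmem.2, h0,
      ?_, ?_, rfl, rfl⟩) <;> rw [Column.mem_move] <;> grind
  · have hc' := hc
    rw [Row.eps_def, Column.phi_def] at hc'
    by_cases hpos : 0 < x.count (lo i)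
    · have : Crystal.f i (b, x) = some (b, x.move i hpos) := by
        simp only [tensor_f, if_neg hc, Row.f_def, dif_pos hpos, Option.map_some]
      rw [this, Option.map_some]
      refine columnRowMap_move i (fun _ _ _ => Iff.rfl)
        (fun k k1 k2 => Row.move_of_ne i x hpos k1 k2)
        (Or.inr ⟨?_, Iff.rfl, Iff.rfl, ?_, Row.move_hi i x hpos⟩)
      · grind
      · rw [Row.move_lo]; omega
    · have : Crystal.f i (b, x) = none := by
        simp only [tensor_f, if_neg hc, Row.f_def, dif_neg hpos, Option.map_none]
      rw [this, Option.map_none]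
      obtain ⟨p, hp, -⟩ := exists_pending b x
      have hlohi := hp.next (lo i)
      rw [cycNext_lo] at hlohi
      have m1 := hp.mem_outColumn (lo i)
      have m2 := hp.mem_outColumn (hi i)
      have c1 := columnRowMap_count b x (lo i)
      have h1 : ¬ Crystal.eps i (outColumn b x) < (columnRowMap (b, x)).1.count (lo i) := by
        rw [Column.eps_def]; grind
      have h2 : ¬ (lo i ∈ outColumn b x ∧ hi i ∉ outColumn b x) := by grind
      simp only [tensor_f, columnRowMap_snd, Row.phi_def, if_neg h1, Column.f_def, dif_neg h2,
        Option.map_none]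

/-- The (unique) crystal isomorphism `B_♮ ⊗ B_ℓ ≃ B_ℓ ⊗ B_♮`. -/
noncomputable def columnRowIso (n ℓ : ℕ) : CrystalIso n (Column n × Row n ℓ) (Row n ℓ × Column n) where
  toEquiv := Equiv.ofBijective columnRowMap columnRowMap_bijective
  map_f := columnRowMap_map_f

end ColumnRow

/-! ### Inhomogeneous paths and the operators `T_ℓ`, `T_♮` -/

section Paths

open Filter

variable {n : ℕ} [n.AtLeastTwo]

/-- The highest weight element `u_ℓ` of `B_ℓ`: all letters are `1`. -/
def Row.highest (n ℓ : ℕ) [n.AtLeastTwo] : Row n ℓ where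
  count k := if k = 0 then ℓ else 0
  sum_count := by simp

/-- The highest weight element `u_♮` of `B_♮`: the column with letters `1, 2`. -/
def Column.highest (n : ℕ) [n.AtLeastTwo] : Column n where
  top := 0
  bot := ⟨1, Nat.AtLeastTwo.prop⟩
  top_lt_bot := by simp [Fin.lt_def]

/-- Sequences `p_1 ⊗ p_2 ⊗ ⋯` with `p_i ∈ B_{ℓ_i}`, where `cap` is the sequence of capacities `ℓ_i`
(the positions `1, 2, 3, …` are numbered `0, 1, 2, …`). -/
abbrev Config (n : ℕ) (cap : ℕ → ℕ) : Type := ∀ i, Row n (cap i)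

variable {cap : ℕ → ℕ}

/-- Membership in the set of inhomogeneous paths: `p_i = u_{ℓ_i}` for `i ≫ 1`. -/
def IsPath (p : Config n cap) : Prop := ∀ᶠ i in atTop, p i = Row.highest n (cap i)

/-- The element of `B_ℓ` standing in front of position `i` when `u_ℓ ⊗ p` is transformed by
applying the isomorphisms `B_ℓ ⊗ B_{ℓ_j} ≃ B_{ℓ_j} ⊗ B_ℓ` at the positions `j` before `i`. -/
def rowCarrier (ℓ : ℕ) (p : Config n cap) : ℕ → Row n ℓ
  | 0 => Row.highest n ℓ
  | i + 1 => ((rowRowIso n ℓ (cap i)).toFun (rowCarrier ℓ p i, p i)).2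

/-- The operator `T_ℓ`, `u_ℓ ⊗ p ↦ T_ℓ(p) ⊗ u_ℓ`. -/
def T (ℓ : ℕ) (p : Config n cap) : Config n cap := fun i =>
  ((rowRowIso n ℓ (cap i)).toFun (rowCarrier ℓ p i, p i)).1

/-- The element of `B_♮` (decoding carrier) standing in front of position `i` when `u_♮ ⊗ p` is
transformed by applying the isomorphisms `B_♮ ⊗ B_{ℓ_j} ≃ B_{ℓ_j} ⊗ B_♮` at the positions `j`
before `i`. -/
noncomputable def columnCarrier (p : Config n cap) : ℕ → Column n
  | 0 => Column.highest n
  | i + 1 => ((columnRowIso n (cap i)).toFun (columnCarrier p i, p i)).2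

/-- The operator `T_♮`, `u_♮ ⊗ p ↦ T_♮(p) ⊗ b(p)`. -/
noncomputable def Tnat (p : Config n cap) : Config n cap := fun i =>
  ((columnRowIso n (cap i)).toFun (columnCarrier p i, p i)).1

open Classical in
/-- The outgoing carrier `b(p)`: the eventual value of the decoding carrier. -/
noncomputable def outCarrier (p : Config n cap) : Column n :=
  if h : ∃ b, ∀ᶠ i in atTop, columnCarrier p i = b then h.choose else Column.highest n

/-- No letter `≥ 3` occurs. -/
def IsMonochrome (p : Config n cap) : Prop := ∀ i, ∀ k : Fin n, 2 ≤ k.val → (p i).count k = 0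

/-- The letter different from `1` of a column one of whose letters is `1`. -/
def Column.colour (b : Column n) : Fin n := b.bot

/-- The word `y_1 … y_N`, where `y_i` is the letter different from `1` of
`b_i = b(T_♮^{N-i}(p))`. -/
noncomputable def colourWord (N : ℕ) (p : Config n cap) : List (Fin n) :=
  (List.range N).map fun j => (outCarrier (Tnat^[N - (j + 1)] p)).colour

end Paths

end BoxBall

namespace BoxBall

/-! The separation statement rests on `T ℓ` and `Tnat` commuting, which is the Yang–Baxter relation
for $B_\natural\otimes B_\ell\otimes B_m$ (`columnPass_rowRowMap`) applied position by position.
Sending both carriers $u_\natural\otimes u_\ell$ through a path in either order gives the same path.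
The carriers start as highest weight elements, which exchange trivially. At the far end the row
carrier is $u_\ell$ again and the column contains the letter 1, so they exchange trivially there as
well. Hence $b(T_\ell(p))=b(p)$ (`outCarrier_T`), and iteration gives the claims on reduced forms
and colour words.

The Yang–Baxter relation is proved by writing both isomorphisms through potentials on the cyclically
ordered letters, a prime denoting the value at the next letter. A column with indicator $b$ crossing
a row $x$ has a 0/1 potential with $p'=\max(b,p-x)$; the row becomes $x+p'-p$ and the column
$b+p-p'$. Two rows $x,y$ with $m\le\ell$ have $Q=y+\max(0,Q'-x)$, and become $y+Q'-Q$ and $x+Q-Q'$.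
For $m<\ell$ a comparison principle around the cycle (`cyc_compare`) nearly determines $Q$ from the
potential $P$ of the two rows already crossed by the column, and from the column potentials $p,q$.
The potentials for the other order are then $q+P-Q$ and $p-P+Q$. Equal widths give the identity map,
and $\ell<m$ follows because the row exchange is an involution.

Decoding terminates because the letters $\ge3$ in every initial segment of the path are conserved up
to those in the carrier: their number never grows, and drops for some segment as long as such a
letter remains. Although the support of the path may grow, it does so only when such letters leave
it, so a lexicographic measure decreases (`exists_isMonochrome`). Paths without letters $\ge3$ are
fixed by `Tnat`, which makes the reduced form unique. -/

theorem Row.sum_count_int {n ℓ : ℕ} (x : Row n ℓ) : ∑ k, (x.count k : ℤ) = ℓ := by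
  exact_mod_cast x.sum_count

/-! ### Cyclic recursions -/

section Cyclic

variable {n : ℕ}

theorem cycNext_bijective : Function.Bijective (cycNext (n := n)) := by
  refine Finite.injective_iff_bijective.1 fun i j h => Fin.ext ?_
  have h := congrArg Fin.val h
  rcases cycNext_cases i with ⟨_, h1⟩ | ⟨_, h1⟩ <;> rcases cycNext_cases j with ⟨_, h2⟩ | ⟨_, h2⟩ <;>
    omega

theorem sum_cycNext (f : Fin n → ℤ) : ∑ k, f (cycNext k) = ∑ k, f k :=
  cycNext_bijective.sum_comp f

/-- A subsolution of `A k = Y k + max 0 (A (k + 1) - X k)` lies below every supersolution. -/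
theorem cyc_compare {X Y A B : Fin n → ℤ} (hs : ∑ k, Y k < ∑ k, X k)
    (hA : ∀ k, A k ≤ Y k + max 0 (A (cycNext k) - X k))
    (hB : ∀ k, Y k + max 0 (B (cycNext k) - X k) ≤ B k) (k : Fin n) : A k ≤ B k := by
  by_contra hk
  -- If `A` exceeds `B` at `k`, the two inequalities force the same at the next letter, so the
  -- excess travels around the whole cycle.
  have lt : ∀ k, ¬ A k ≤ B k := cyc_induction hk fun k hk => by
    have := hA k
    have := hB k
    omega
  -- Under a strict excess the maximum on the side of `A` is not attained by 0. Summed over the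
  -- cycle, `A` cancels and the sum of `X` would be at most that of `Y`.
  have le : ∀ k, A k ≤ Y k + A (cycNext k) - X k := fun k => by
    have := hA k
    have := hB k
    have := lt k
    omega
  have := Finset.sum_le_sum fun k (_ : k ∈ Finset.univ) => le k
  rw [Finset.sum_sub_distrib, Finset.sum_add_distrib, sum_cycNext] at this
  omega

end Cyclic

/-! ### The potential of two rows as a solution of a cyclic recursion -/

section RowRow

variable {n : ℕ} [n.AtLeastTwo] {ℓ m : ℕ}

theorem rowP_cycNext (x : Row n ℓ) (y : Row n m) (k : Fin n) :
    rowP x y (k.val + 1) = rowP x y (cycNext k).val := by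
  rcases cycNext_cases k with ⟨_, h⟩ | ⟨h1, h⟩
  · rw [h]
  · rw [h, h1]
    have := windowMax_period (n := n) x.cyc_period y.cyc_period 0
    rwa [Nat.zero_add] at this

theorem partialDiff_cyc (x : Row n ℓ) (y : Row n m) :
    partialDiff x.cyc y.cyc n = (m : ℤ) - ℓ := by
  unfold partialDiff
  rw [← Fin.sum_univ_eq_sum_range (fun k => y.cyc k - x.cyc k) n]
  simp only [Row.cyc_val, Finset.sum_sub_distrib, Row.sum_count_int]

/-- The windows starting at `i` and `i + 1` differ only in the indices `i` and `i + n`. Going once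
around the cycle changes the partial sums by `m - ℓ ≤ 0`, so the term at `i + n` never beats the one
at `i`. -/
theorem rowP_rec (h : m ≤ ℓ) (x : Row n ℓ) (y : Row n m) (k : Fin n) :
    rowP x y k.val = y.count k + max 0 (rowP x y (cycNext k).val - x.count k) := by
  rw [← rowP_cycNext, ← Row.cyc_val, ← Row.cyc_val]
  generalize k.val = i
  unfold rowP
  have hpos := NeZero.pos n
  have hD := partialDiff_cyc x y
  have hs := partialDiff_succ x.cyc y.cyc i
  have hp := partialDiff_period x.cyc_period y.cyc_period i
  have h0 := windowMax_ub x.cyc y.cyc (n := n) (i := i) (j := i) le_rfl (by omega)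
  obtain ⟨j, h1, h2, h3⟩ := windowMax_att n x.cyc y.cyc i
  obtain ⟨j', h1', h2', h3'⟩ := windowMax_att n x.cyc y.cyc (i + 1)
  have up : windowMax n x.cyc y.cyc (i + 1) ≤ x.cyc i ∨ y.cyc i - x.cyc i +
      windowMax n x.cyc y.cyc (i + 1) ≤ windowMax n x.cyc y.cyc i := by
    by_cases e : j' < i + n
    · have := windowMax_ub x.cyc y.cyc (n := n) (i := i) (j := j') (by omega) e
      omega
    -- At the wrapped index the value at `i + 1` is `x.cyc i + m - ℓ`, which the hypothesis bounds
    -- by `x.cyc i`.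
    · obtain rfl : j' = i + n := by omega
      rw [Row.cyc_period] at h3'
      omega
  have low : windowMax n x.cyc y.cyc i = y.cyc i ∨ windowMax n x.cyc y.cyc i ≤
      y.cyc i - x.cyc i + windowMax n x.cyc y.cyc (i + 1) := by
    rcases h1.eq_or_lt with rfl | h1
    · omega
    · have := windowMax_ub x.cyc y.cyc (n := n) (i := i + 1) (j := j) h1 (by omega)
      omega
  omega

/-- The recursion gives $P+x-y-P'\ge0$ at every letter. For equal widths these slacks sum to zero,
hence all vanish, and the exchange changes nothing. -/
theorem rowRowMap_self (z : Row n ℓ × Row n ℓ) : rowRowMap z = z := by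
  obtain ⟨x, y⟩ := z
  have hle : ∀ k ∈ Finset.univ, 0 ≤
      rowP x y (Fin.val k) + x.count k - y.count k - rowP x y (cycNext k).val := fun k _ => by
    have := rowP_rec le_rfl x y k
    omega
  have hsum : ∑ k : Fin n,
      (rowP x y k.val + x.count k - y.count k - rowP x y (cycNext k).val) = 0 := by
    rw [Finset.sum_sub_distrib, Finset.sum_sub_distrib, Finset.sum_add_distrib,
      sum_cycNext fun k => rowP x y k.val, x.sum_count_int, y.sum_count_int]
    ring
  have heq := (Finset.sum_eq_zero_iff_of_nonneg hle).1 hsum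
  refine Prod.ext (Row.ext (funext fun k => ?_)) (Row.ext (funext fun k => ?_))
  · have := rowRowMap_fst x y k
    have := heq k (Finset.mem_univ k)
    rw [← rowP_cycNext] at this
    dsimp only
    omega
  · have := rowRowMap_snd x y k
    have := heq k (Finset.mem_univ k)
    rw [← rowP_cycNext] at this
    dsimp only
    omega

end RowRow

/-! ### The Yang–Baxter relation -/

section YangBaxter

variable {n ℓ m : ℕ}

/-- The indicator function of a column. -/
def Column.ind (b : Column n) (k : Fin n) : ℤ := if k ∈ b then 1 else 0

theorem Column.ext_ind {b c : Column n} (h : ∀ k, b.ind k = c.ind k) : b = c := by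
  refine Column.ext_mem fun k => ?_
  have := h k
  unfold Column.ind at this
  split_ifs at this <;> simp_all

theorem Column.ind_cases (b : Column n) (k : Fin n) : b.ind k = 0 ∨ b.ind k = 1 := by
  unfold Column.ind; split_ifs <;> simp

/-- Integer form of `Pending`. -/
structure IsTransfer (b : Column n) (x : Row n ℓ) (p : Fin n → ℤ) : Prop where
  bit : ∀ k, p k = 0 ∨ p k = 1
  next : ∀ k, p (cycNext k) = max (b.ind k) (p k - x.count k)

theorem IsTransfer.pending {b : Column n} {x : Row n ℓ} {p : Fin n → ℤ} (hp : IsTransfer b x p)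
    (hℓ : ℓ ≠ 0) : Pending b x fun k => p k = 1 := by
  refine ⟨fun k => ?_, fun h => (hℓ h).elim⟩
  have h1 := hp.next k
  have h2 := hp.bit k
  unfold Column.ind at h1
  by_cases h : k ∈ b <;> simp only [h, if_true, if_false, true_or, false_or, iff_true] at h1 ⊢ <;>
    omega

theorem exists_isTransfer (b : Column n) (x : Row n ℓ) : ∃ p, IsTransfer b x p := by
  classical
  obtain ⟨p, hp, -⟩ := exists_pending b x
  refine ⟨fun k => if p k then 1 else 0, fun k => by split_ifs <;> simp, fun k => ?_⟩
  have h := hp.next k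
  unfold Column.ind
  by_cases h1 : k ∈ b <;> by_cases h2 : p k <;> by_cases h3 : x.count k = 0 <;>
    simp_all; omega

/-- The potential acts as a flow: what enters at `k`, from the column or as pending from before,
either leaves in the new column or stays pending. For nonempty rows the flow is unique, so any `p`
with `IsTransfer` computes `outColumn`. -/
theorem IsTransfer.ind_outColumn {b : Column n} {x : Row n ℓ} {p : Fin n → ℤ}
    (hp : IsTransfer b x p) (hℓ : ℓ ≠ 0) (k : Fin n) :
    (outColumn b x).ind k = b.ind k + p k - p (cycNext k) := by
  have h := (hp.pending hℓ).mem_outColumn k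
  have h1 := hp.next k
  have h2 := hp.bit k
  unfold Column.ind at *
  by_cases h3 : k ∈ b <;> by_cases h4 : k ∈ outColumn b x <;> simp only [h3, h4, if_true, if_false,
    true_iff, false_iff, or_true, or_false, and_true] at * <;> omega

theorem IsTransfer.count {b : Column n} {x : Row n ℓ} {p : Fin n → ℤ}
    (hp : IsTransfer b x p) (hℓ : ℓ ≠ 0) (k : Fin n) :
    ((columnRowMap (b, x)).1.count k : ℤ) = x.count k + p (cycNext k) - p k := by
  have h1 := columnRowMap_count b x k
  have h2 := hp.ind_outColumn hℓ k
  unfold Column.ind at h2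
  split_ifs at * <;> omega

/-- A column passes through two rows. -/
def columnPass (b : Column n) (z : Row n ℓ × Row n m) : (Row n ℓ × Row n m) × Column n :=
  (((columnRowMap (b, z.1)).1, (columnRowMap (outColumn b z.1, z.2)).1),
    outColumn (outColumn b z.1) z.2)

/-- One step of the row recursion and of the two column recursions, before and after the
exchange of the two rows. -/
theorem transfer_step {b p q p' q' P P' Q Q' x y : ℤ} (hx : 0 ≤ x) (hy : 0 ≤ y)
    (hb : b = 0 ∨ b = 1) (hp : p = 0 ∨ p = 1) (hq : q = 0 ∨ q = 1) (h0 : 0 ≤ P) (h0' : 0 ≤ P')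
    (e : ¬ (p = 1 ∧ q = 0 ∧ P = 0)) (np : p' = max b (p - x)) (nq : q' = max (b + p - p') (q - y))
    (hP : P = y + q' - q + max 0 (P' - (x + p' - p))) (hQ : Q = y + max 0 (Q' - x))
    (h : Q = P + q - p ∨ p = 0 ∧ q = 1 ∧ P = 0 ∧ Q = 0)
    (h' : Q' = P' + q' - p' ∨ p' = 0 ∧ q' = 1 ∧ P' = 0 ∧ Q' = 0) :
    q' + P' - Q' = max b (q + P - Q - (y + Q' - Q)) ∧
      p' - P' + Q' = max (b + (q + P - Q) - (q' + P' - Q')) (p - P + Q - (x + Q - Q')) := by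
  rcases h with h | ⟨h1, h2, h3, h4⟩ <;> rcases h' with h' | ⟨h1', h2', h3', h4'⟩ <;>
    rcases hb with rfl | rfl <;> rcases hp with rfl | rfl <;> rcases hq with rfl | rfl <;>
    constructor <;> omega

/-- Local form of the squeeze on `Q`: the first inequality makes $P+q-p$, cut to 0 where $P=0$, a
subsolution of the recursion for `Q`; the second makes $P+q-p$ itself a supersolution. -/
theorem transfer_bounds {b p q p' q' P P' x y : ℤ} (hx : 0 ≤ x) (hy : 0 ≤ y)
    (hb : b = 0 ∨ b = 1) (hp : p = 0 ∨ p = 1) (hq : q = 0 ∨ q = 1) (h0 : 0 ≤ P) (h0' : 0 ≤ P')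
    (e : ¬ (p = 1 ∧ q = 0 ∧ P = 0)) (e' : ¬ (p' = 1 ∧ q' = 0 ∧ P' = 0))
    (np : p' = max b (p - x)) (nq : q' = max (b + p - p') (q - y))
    (hP : P = y + q' - q + max 0 (P' - (x + p' - p))) :
    (if P = 0 then 0 else P + q - p) ≤ y + max 0 ((if P' = 0 then 0 else P' + q' - p') - x) ∧
      y + max 0 (P' + q' - p' - x) ≤ P + q - p := by
  rcases hb with rfl | rfl <;> rcases hp with rfl | rfl <;> rcases hq with rfl | rfl <;>
    constructor <;> try split_ifs
  all_goals omega

/-- In this configuration $P+q-p$ would be negative. It reproduces itself at the next letter and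
forces `x = 0`, so it cannot occur for a nonempty row. -/
theorem transfer_exceptional {b p q p' q' P P' x y : ℤ} (hx : 0 ≤ x) (hy : 0 ≤ y)
    (hb : b = 0 ∨ b = 1) (h0' : 0 ≤ P')
    (np : p' = max b (p - x)) (nq : q' = max (b + p - p') (q - y))
    (hP : P = y + q' - q + max 0 (P' - (x + p' - p))) (h : p = 1 ∧ q = 0 ∧ P = 0) :
    p' = 1 ∧ q' = 0 ∧ P' = 0 ∧ x = 0 ∧ b = 0 := by
  obtain ⟨rfl, rfl, rfl⟩ := h
  rcases hb with rfl | rfl <;> omega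

variable [n.AtLeastTwo]

/-- Strictness of `m < ℓ` is what the comparison principle needs. Here `p`, `q` are the column
potentials for the original rows, `P` the row potential after the column has passed, and `Q` the one
before. -/
theorem columnPass_rowRowMap_of_lt (hm : m ≠ 0) (h : m < ℓ) (b : Column n)
    (z : Row n ℓ × Row n m) :
    columnPass b (rowRowMap z) = (rowRowMap (columnPass b z).1, (columnPass b z).2) := by
  obtain ⟨x, y⟩ := z
  have hℓ : ℓ ≠ 0 := by omega
  obtain ⟨p, hp⟩ := exists_isTransfer b x
  obtain ⟨q, hq⟩ := exists_isTransfer (outColumn b x) y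
  have ec := hp.ind_outColumn hℓ
  have ed := hq.ind_outColumn hm
  have ex := hp.count hℓ
  have ey := hq.count hm
  have hP := rowP_rec h.le (columnRowMap (b, x)).1 (columnRowMap (outColumn b x, y)).1
  have hQ := rowP_rec h.le x y
  have ey2 := rowRowMap_fst (columnRowMap (b, x)).1 (columnRowMap (outColumn b x, y)).1
  have ex2 := rowRowMap_snd (columnRowMap (b, x)).1 (columnRowMap (outColumn b x, y)).1
  have ey' := rowRowMap_fst x y
  have ex' := rowRowMap_snd x y
  simp only [rowP_cycNext] at ey2 ex2 ey' ex'
  set P : Fin n → ℤ := fun k =>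
    rowP (columnRowMap (b, x)).1 (columnRowMap (outColumn b x, y)).1 k.val with hPdef
  set Q : Fin n → ℤ := fun k => rowP x y k.val with hQdef
  change ∀ k, P k = _ + max 0 (P (cycNext k) - _) at hP
  change ∀ k, Q k = _ + max 0 (Q (cycNext k) - _) at hQ
  change ∀ k, _ = _ + P (cycNext k) - P k at ey2
  change ∀ k, _ = _ + P k - P (cycNext k) at ex2
  change ∀ k, _ = _ + Q (cycNext k) - Q k at ey'
  change ∀ k, _ = _ + Q k - Q (cycNext k) at ex'
  clear_value P Q
  have hsum : ∑ k, (y.count k : ℤ) < ∑ k, (x.count k : ℤ) := by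
    rw [x.sum_count_int, y.sum_count_int]; omega
  have cb := b.ind_cases
  have bp := hp.bit
  have bq := hq.bit
  have np := hp.next
  have nq := hq.next
  have P0 : ∀ k, 0 ≤ P k := fun k => by have := hP k; omega
  have nq' := fun k => (nq k).trans (by rw [ec k])
  have hP' := fun k => (hP k).trans (by rw [ex k, ey k])
  -- Otherwise the excluded configuration would fill the cycle and all counts of `x` would vanish,
  -- contradicting `ℓ ≠ 0`.
  have excl : ∀ k, ¬ (p k = 1 ∧ q k = 0 ∧ P k = 0) := by
    intro k hk
    have exc := fun k => transfer_exceptional (Int.natCast_nonneg (x.count k))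
      (Int.natCast_nonneg (y.count k)) (cb k) (P0 (cycNext k)) (np k) (nq' k) (hP' k)
    have all : ∀ k, p k = 1 ∧ q k = 0 ∧ P k = 0 := cyc_induction hk fun k hk => by
      have := exc k hk
      tauto
    obtain ⟨k, hk⟩ := x.exists_pos hℓ
    have := exc k (all k)
    omega
  have bounds := fun k => transfer_bounds (Int.natCast_nonneg (x.count k))
    (Int.natCast_nonneg (y.count k)) (cb k) (bp k) (bq k) (P0 k) (P0 (cycNext k)) (excl k)
    (excl (cycNext k)) (np k) (nq' k) (hP' k)
  have hi : ∀ k, Q k ≤ P k + q k - p k :=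
    cyc_compare (B := fun k => P k + q k - p k) hsum (fun k => (hQ k).le) fun k => (bounds k).2
  have low : ∀ k, (if P k = 0 then 0 else P k + q k - p k) ≤ Q k :=
    cyc_compare (A := fun k => if P k = 0 then 0 else P k + q k - p k) hsum
      (fun k => (bounds k).1) fun k => (hQ k).ge
  -- The two bounds coincide unless $P=0$. In that case `excl` leaves only $p=0$, $q=1$ undecided,
  -- with $Q$ equal to 0 or 1.
  have rel : ∀ k, Q k = P k + q k - p k ∨ p k = 0 ∧ q k = 1 ∧ P k = 0 ∧ Q k = 0 := fun k => by
    have := hi k; have := low k; have := bp k; have := bq k; have := excl k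
    split_ifs at * <;> omega
  have step := fun k => transfer_step (Int.natCast_nonneg (x.count k))
    (Int.natCast_nonneg (y.count k)) (cb k) (bp k) (bq k) (P0 k) (P0 (cycNext k)) (excl k)
    (np k) (nq' k) (hP' k) (hQ k) (rel k) (rel (cycNext k))
  -- This potential is dictated by requiring the same final rows in both orders. By `rel` the new
  -- pair of potentials is $(p,q)$, or $(1,0)$ in place of $(0,1)$, so both are again bits.
  have hr : IsTransfer b (rowRowMap (x, y)).1 fun k => q k + P k - Q k := by
    refine ⟨fun k => ?_, fun k => ?_⟩
    · have := rel k; have := bp k; have := bq k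
      omega
    · rw [(step k).1, ey' k]
  have ec' := hr.ind_outColumn hm
  have hs : IsTransfer (outColumn b (rowRowMap (x, y)).1) (rowRowMap (x, y)).2
      fun k => p k - P k + Q k := by
    refine ⟨fun k => ?_, fun k => ?_⟩
    · have := rel k; have := bp k; have := bq k
      omega
    · rw [(step k).2, ec' k, ex' k]
  have ed' := hs.ind_outColumn hℓ
  have ey'' := hr.count hm
  have ex'' := hs.count hℓ
  refine Prod.ext (Prod.ext (Row.ext (funext fun k => ?_)) (Row.ext (funext fun k => ?_)))
    (Column.ext_ind fun k => ?_)
  · have := ey2 k; have := ey'' k; have := ey' k; have := ey k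
    simp only [columnPass] at *
    omega
  · have := ex2 k; have := ex'' k; have := ex' k; have := ex k
    simp only [columnPass] at *
    omega
  · have := ed k; have := ed' k; have := ec k; have := ec' k
    simp only [columnPass] at *
    omega

/-- The Yang–Baxter relation on `B_♮ ⊗ B_ℓ ⊗ B_m`. -/
theorem columnPass_rowRowMap (hℓ : ℓ ≠ 0) (hm : m ≠ 0) (b : Column n) (z : Row n ℓ × Row n m) :
    columnPass b (rowRowMap z) = (rowRowMap (columnPass b z).1, (columnPass b z).2) := by
  rcases lt_trichotomy ℓ m with h | rfl | h
  -- After the exchange the wider row stands first; the involution carries the relation back.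
  · have := columnPass_rowRowMap_of_lt hℓ h b (rowRowMap z)
    rw [rowRowMap_rowRowMap] at this
    rw [this, rowRowMap_rowRowMap]
  · simp [rowRowMap_self]
  · exact columnPass_rowRowMap_of_lt hm h b z

end YangBaxter


/-! ### Highest weight elements under the isomorphisms -/

section Highest

variable {n ℓ m : ℕ}

theorem Row.count_le (x : Row n ℓ) (k : Fin n) : x.count k ≤ ℓ :=
  (Finset.single_le_sum (f := x.count) (fun _ _ => Nat.zero_le _) (Finset.mem_univ k)).trans_eq
    x.sum_count

/-- Such a letter rules out all cases of `outColumn` but (IV) and (V), and in both the lower entry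
is a letter of the row above `b.bot`. -/
theorem lt_outColumn_bot {b : Column n} {x : Row n ℓ} {k : Fin n} (hk : b.bot < k)
    (hx : 0 < x.count k) : b.bot < (outColumn b x).bot := by
  have h1 : x.letters.Nonempty := ⟨k, (x.mem_letters k).2 hx⟩
  have h2 : (x.above b.top).Nonempty := ⟨k, (x.mem_above _ k).2 ⟨b.top_lt_bot.trans hk, hx⟩⟩
  have h3 : (x.above b.bot).Nonempty := ⟨k, (x.mem_above _ k).2 ⟨hk, hx⟩⟩
  rw [outColumn, dif_pos h1, dif_pos h2, dif_pos h3]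
  split_ifs with h
  · exact ((x.mem_above _ _).1 (Finset.min'_mem _ h3)).1
  · exact not_le.1 h

theorem columnRowMap_of_outColumn {b : Column n} {x : Row n ℓ} (h : outColumn b x = b) :
    columnRowMap (b, x) = (x, b) := by
  refine Prod.ext (Row.ext (funext fun k => ?_)) h
  have := columnRowMap_count b x k
  rw [h] at this
  exact Nat.add_right_cancel this

variable [n.AtLeastTwo]

theorem Row.highest_count_of_ne {k : Fin n} (hk : k ≠ 0) : (Row.highest n ℓ).count k = 0 :=
  if_neg hk

theorem Row.highest_count_zero : (Row.highest n ℓ).count 0 = ℓ := by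
  simp [Row.highest]

theorem Row.eq_highest {x : Row n ℓ} (h : ℓ ≤ x.count 0) : x = Row.highest n ℓ := by
  have h0 : x.count 0 = ℓ := (x.count_le 0).antisymm h
  refine Row.ext (funext fun k => ?_)
  by_cases hk : k = 0
  · rw [hk, h0, Row.highest_count_zero]
  · have := Finset.add_le_sum (f := x.count) (fun _ _ => Nat.zero_le _) (Finset.mem_univ k)
      (Finset.mem_univ 0) hk
    rw [x.sum_count] at this
    rw [Row.highest_count_of_ne hk]
    omega

theorem outColumn_highest (hℓ : ℓ ≠ 0) (b : Column n) :
    (outColumn b (Row.highest n ℓ)).top = 0 ∧ (outColumn b (Row.highest n ℓ)).bot = b.bot := by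
  have mem : ∀ k, k ∈ (Row.highest n ℓ).letters → k = 0 := fun k hk => by
    by_contra h
    rw [Row.mem_letters, Row.highest_count_of_ne h] at hk
    omega
  have h1 : (Row.highest n ℓ).letters.Nonempty :=
    ⟨0, (Row.mem_letters _ _).2 (by rw [Row.highest_count_zero]; omega)⟩
  have h2 : ¬ ((Row.highest n ℓ).above b.top).Nonempty := by
    rintro ⟨k, hk⟩
    rw [Row.mem_above] at hk
    rw [mem k ((Row.mem_letters _ _).2 hk.2)] at hk
    exact absurd hk.1 (Fin.not_lt_zero _)
  rw [outColumn, dif_pos h1, dif_neg h2]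
  exact ⟨mem _ (Finset.min'_mem _ h1), rfl⟩

theorem columnRowMap_highest (hℓ : ℓ ≠ 0) {b : Column n} (hb : b.top = 0) :
    columnRowMap (b, Row.highest n ℓ) = (Row.highest n ℓ, b) :=
  columnRowMap_of_outColumn
    (Column.ext ((outColumn_highest hℓ b).1.trans hb.symm) (outColumn_highest hℓ b).2)

theorem rowP_highest_zero (x : Row n ℓ) :
    (m : ℤ) ≤ rowP x (Row.highest n m) 0 := by
  have := windowMax_ub x.cyc (Row.highest n m).cyc (n := n) (i := 0) (j := 0) le_rfl
    (by have := NeZero.pos n; omega)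
  have h : (Row.highest n m).cyc 0 = m := by
    have := Row.cyc_val (Row.highest n m) 0
    rwa [Row.highest_count_zero] at this
  unfold rowP
  omega

/-- On the window from 1 to `n` the row $u_m$ contributes nothing before the wrapped index `n`, and
the partial sums do not increase, so those terms are at most 0. The term at `n` is $m-(\ell-x_0)$,
where $x_0$ is the number of letters 1 in `x`. -/
theorem rowP_highest_one (x : Row n ℓ) :
    rowP x (Row.highest n m) 1 ≤ max 0 ((m : ℤ) - (ℓ - x.count 0)) := by
  have hx0 : x.cyc 0 = x.count 0 := Row.cyc_val x 0
  have h0 : (Row.highest n m).cyc 0 = m := by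
    have := Row.cyc_val (Row.highest n m) 0
    rwa [Row.highest_count_zero] at this
  have hne : ∀ j, 1 ≤ j → j < n → (Row.highest n m).cyc j = 0 := fun j h1 h2 => by
    have := Row.cyc_val (Row.highest n m) ⟨j, h2⟩
    rwa [Row.highest_count_of_ne (by simp [Fin.ext_iff]; omega)] at this
  have hD : partialDiff x.cyc (Row.highest n m).cyc 1 = m - x.count 0 := by
    rw [← h0, ← hx0]; simp [partialDiff]
  have hmono : ∀ j, 1 ≤ j → j ≤ n → partialDiff x.cyc (Row.highest n m).cyc j ≤
      partialDiff x.cyc (Row.highest n m).cyc 1 := by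
    intro j h1
    induction j, h1 using Nat.le_induction with
    | base => intro _; exact le_rfl
    | succ j h1 ih =>
      intro h2
      have := ih (by omega)
      have := partialDiff_succ x.cyc (Row.highest n m).cyc j
      have := hne j h1 h2
      have := x.cyc_nonneg j
      omega
  obtain ⟨j, h1, h2, h3⟩ := windowMax_att n x.cyc (Row.highest n m).cyc 1
  unfold rowP
  by_cases h : j < n
  · have := hne j h1 h
    have := hmono j h1 h.le
    omega
  · obtain rfl : j = n := by omega
    have hp := (Row.highest j m).cyc_period 0
    have := partialDiff_cyc x (Row.highest j m)
    rw [Nat.zero_add] at hp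
    omega

/-- A row passing through `u_m` exchanges letters `≠ 1` for letters `1`. -/
theorem rowRowMap_highest_count (x : Row n ℓ) :
    (x.count 0 : ℤ) + min (m : ℤ) (ℓ - x.count 0) ≤
      (rowRowMap (x, Row.highest n m)).2.count 0 := by
  have h1 := rowRowMap_snd x (Row.highest n m) 0
  have h2 := rowP_highest_zero (m := m) x
  have h3 := rowP_highest_one (m := m) x
  rw [Fin.val_zero, Nat.zero_add] at h1
  have := x.count_le 0
  omega

theorem rowRowMap_highest :
    rowRowMap (Row.highest n ℓ, Row.highest n m) = (Row.highest n m, Row.highest n ℓ) := by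
  have h1 := rowRowMap_fst (Row.highest n ℓ) (Row.highest n m) 0
  have h2 := rowRowMap_snd (Row.highest n ℓ) (Row.highest n m) 0
  have h3 := rowP_highest_zero (m := m) (Row.highest n ℓ)
  have h4 := rowP_highest_one (m := m) (Row.highest n ℓ)
  rw [Fin.val_zero, Nat.zero_add] at h1 h2
  simp only [Row.highest_count_zero, sub_self, sub_zero, max_eq_right (Int.natCast_nonneg m)]
    at h1 h2 h4
  have h5 := (rowRowMap (Row.highest n ℓ, Row.highest n m)).2.count_le 0
  exact Prod.ext (Row.eq_highest (by omega)) (Row.eq_highest (by omega))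

theorem Column.eq_highest {b : Column n} (h : ∀ k ∈ b, k.val < 2) : b = Column.highest n := by
  have h1 := h b.bot ((b.mem_def _).2 (Or.inr rfl))
  have h2 := Fin.lt_def.1 b.top_lt_bot
  refine Column.ext (Fin.ext ?_) (Fin.ext ?_)
  · change b.top.val = 0; omega
  · change b.bot.val = 1; omega

theorem Column.val_lt_two_of_mem_highest {k : Fin n} (h : k ∈ Column.highest n) : k.val < 2 := by
  rcases (Column.mem_def _ k).1 h with rfl | rfl
  · exact Nat.zero_lt_two
  · exact Nat.one_lt_two

end Highest

/-! ### Counting letters `≥ 3` -/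

section High

variable {n : ℕ}

/-- The number of letters `≥ 3` in a row. -/
def Row.high {ℓ : ℕ} (x : Row n ℓ) : ℕ := ∑ k, if 2 ≤ k.val then x.count k else 0

/-- The number of letters `≥ 3` in a column. -/
def Column.high (b : Column n) : ℕ := ∑ k, if 2 ≤ k.val then (if k ∈ b then 1 else 0) else 0

theorem Row.high_eq_zero {ℓ : ℕ} {x : Row n ℓ} :
    x.high = 0 ↔ ∀ k : Fin n, 2 ≤ k.val → x.count k = 0 := by
  simp [Row.high, Finset.sum_eq_zero_iff]

theorem Column.high_pos {b : Column n} : 0 < b.high ↔ 2 ≤ b.bot.val := by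
  rw [Nat.pos_iff_ne_zero, Ne, Column.high, Finset.sum_eq_zero_iff]
  have := Fin.lt_def.1 b.top_lt_bot
  simp only [Finset.mem_univ, forall_const, ite_eq_right_iff, one_ne_zero, imp_false, not_forall,
    not_not, Column.mem_def]
  exact ⟨by rintro ⟨k, h, rfl | rfl⟩ <;> omega, fun h => ⟨_, h, Or.inr rfl⟩⟩

theorem high_columnRowMap {ℓ : ℕ} (b : Column n) (x : Row n ℓ) :
    (columnRowMap (b, x)).1.high + (outColumn b x).high = x.high + b.high := by
  unfold Row.high Column.high
  rw [← Finset.sum_add_distrib, ← Finset.sum_add_distrib]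
  refine Finset.sum_congr rfl fun k _ => ?_
  have := columnRowMap_count b x k
  split_ifs at * <;> simp_all

variable {cap : ℕ → ℕ}

/-- The number of letters `≥ 3` at the first `L` positions. -/
def prefixHigh (p : Config n cap) (L : ℕ) : ℕ := ∑ i ∈ Finset.range L, (p i).high

theorem prefixHigh_succ (p : Config n cap) (L : ℕ) :
    prefixHigh p (L + 1) = prefixHigh p L + (p L).high := Finset.sum_range_succ _ _

end High

/-! ### The operators on paths -/

section Operators

open Filter

variable {n : ℕ} [n.AtLeastTwo] {cap : ℕ → ℕ}

theorem rowCarrier_succ (ℓ : ℕ) (p : Config n cap) (i : ℕ) :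
    rowCarrier ℓ p (i + 1) = (rowRowMap (rowCarrier ℓ p i, p i)).2 := rfl

theorem T_apply (ℓ : ℕ) (p : Config n cap) (i : ℕ) :
    T ℓ p i = (rowRowMap (rowCarrier ℓ p i, p i)).1 := rfl

theorem columnCarrier_succ (p : Config n cap) (i : ℕ) :
    columnCarrier p (i + 1) = outColumn (columnCarrier p i) (p i) := rfl

theorem Tnat_apply (p : Config n cap) (i : ℕ) :
    Tnat p i = (columnRowMap (columnCarrier p i, p i)).1 := rfl

/-- Beyond the support each row $u_{\ell_i}$ has at least one letter 1 to trade for another letter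
of the carrier, so `ℓ` further positions suffice. -/
theorem eventually_rowCarrier (hcap : ∀ i, 1 ≤ cap i) (ℓ : ℕ) {p : Config n cap} (hp : IsPath p) :
    ∀ᶠ i in atTop, rowCarrier ℓ p i = Row.highest n ℓ := by
  obtain ⟨K, hK⟩ := eventually_atTop.1 hp
  have key : ∀ t, min t ℓ ≤ (rowCarrier ℓ p (K + t)).count 0 := by
    intro t
    induction t with
    | zero => simp
    | succ t ih =>
      have := rowRowMap_highest_count (m := cap (K + t)) (rowCarrier ℓ p (K + t))
      have := hcap (K + t)
      have := (rowCarrier ℓ p (K + t)).count_le 0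
      rw [← add_assoc, rowCarrier_succ, hK _ (Nat.le_add_right K t)]
      omega
  refine eventually_atTop.2 ⟨K + ℓ, fun i hi => Row.eq_highest ?_⟩
  have := key (i - K)
  rw [Nat.add_sub_of_le (by omega)] at this
  omega

theorem isPath_T (hcap : ∀ i, 1 ≤ cap i) (ℓ : ℕ) {p : Config n cap} (hp : IsPath p) :
    IsPath (T ℓ p) := by
  filter_upwards [hp, eventually_rowCarrier hcap ℓ hp] with i h1 h2
  rw [T_apply, h1, h2, rowRowMap_highest]

/-- The first row of letters 1 brings a 1 into the column; from then on such rows leave it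
unchanged. This is why the bound is `L + 1` and not `L`. -/
theorem columnCarrier_of_highest (hcap : ∀ i, 1 ≤ cap i) {p : Config n cap} {L : ℕ}
    (hL : ∀ i, L ≤ i → p i = Row.highest n (cap i)) {i : ℕ} (hi : L + 1 ≤ i) :
    columnCarrier p i = columnCarrier p (L + 1) ∧ (columnCarrier p i).top = 0 := by
  induction i, hi using Nat.le_induction with
  | base =>
    refine ⟨rfl, ?_⟩
    rw [columnCarrier_succ, hL L le_rfl]
    exact (outColumn_highest (by have := hcap L; omega) _).1
  | succ i hi ih =>
    have h : columnCarrier p (i + 1) = columnCarrier p i := by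
      rw [columnCarrier_succ, hL i (by omega)]
      exact congrArg Prod.snd (columnRowMap_highest (by have := hcap i; omega) ih.2)
    rw [h]
    exact ih

theorem outCarrier_eq {p : Config n cap} {b : Column n}
    (h : ∀ᶠ i in atTop, columnCarrier p i = b) : outCarrier p = b := by
  have h' : ∃ b, ∀ᶠ i in atTop, columnCarrier p i = b := ⟨b, h⟩
  rw [outCarrier, dif_pos h']
  obtain ⟨i, h1, h2⟩ := (h'.choose_spec.and h).exists
  exact h1.symm.trans h2

theorem eventually_columnCarrier (hcap : ∀ i, 1 ≤ cap i) {p : Config n cap} (hp : IsPath p) :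
    (∀ᶠ i in atTop, columnCarrier p i = outCarrier p) ∧ (outCarrier p).top = 0 := by
  obtain ⟨L, hL⟩ := eventually_atTop.1 hp
  have h : ∀ᶠ i in atTop, columnCarrier p i = columnCarrier p (L + 1) :=
    eventually_atTop.2 ⟨L + 1, fun i hi => (columnCarrier_of_highest hcap hL hi).1⟩
  rw [outCarrier_eq h]
  exact ⟨h, (columnCarrier_of_highest hcap hL le_rfl).2⟩

theorem isPath_Tnat (hcap : ∀ i, 1 ≤ cap i) {p : Config n cap} (hp : IsPath p) :
    IsPath (Tnat p) := by
  obtain ⟨h, h0⟩ := eventually_columnCarrier hcap hp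
  filter_upwards [hp, h] with i h1 h2
  rw [Tnat_apply, h1, h2, columnRowMap_highest (by have := hcap i; omega) h0]

theorem isPath_iterate_Tnat (hcap : ∀ i, 1 ≤ cap i) {p : Config n cap} (hp : IsPath p) (N : ℕ) :
    IsPath (Tnat^[N] p) := by
  induction N with
  | zero => exact hp
  | succ N ih => rw [Function.iterate_succ_apply']; exact isPath_Tnat hcap ih

/-! ### Commutation of `T_ℓ` and `T_♮` -/

/-- The first component is the invariant of the induction: exchanging the two carriers in front of
position `i` turns those for `Tnat` after `T ℓ` into those for `T ℓ` after `Tnat`. The Yang–Baxter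
relation moves it past position `i`, giving equality of the two paths there. -/
theorem columnRowMap_carrier (hcap : ∀ i, 1 ≤ cap i) {ℓ : ℕ} (hℓ : 1 ≤ ℓ) (p : Config n cap)
    (i : ℕ) : columnRowMap (columnCarrier (T ℓ p) i, rowCarrier ℓ p i) =
      (rowCarrier ℓ (Tnat p) i, columnCarrier p i) ∧ T ℓ (Tnat p) i = Tnat (T ℓ p) i := by
  have step : ∀ i, columnRowMap (columnCarrier (T ℓ p) i, rowCarrier ℓ p i) =
      (rowCarrier ℓ (Tnat p) i, columnCarrier p i) →
      columnRowMap (columnCarrier (T ℓ p) (i + 1), rowCarrier ℓ p (i + 1)) =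
      (rowCarrier ℓ (Tnat p) (i + 1), columnCarrier p (i + 1)) ∧
      T ℓ (Tnat p) i = Tnat (T ℓ p) i := by
    intro i ih
    have yb := columnPass_rowRowMap (by omega) (by have := hcap i; omega)
      (columnCarrier (T ℓ p) i) (rowCarrier ℓ p i, p i)
    have h1 := congrArg Prod.fst ih
    have h2 : outColumn (columnCarrier (T ℓ p) i) (rowCarrier ℓ p i) = columnCarrier p i :=
      congrArg Prod.snd ih
    simp only [columnPass, h2] at yb h1
    rw [h1] at yb
    simp only [Prod.ext_iff] at yb
    exact ⟨Prod.ext yb.1.2 yb.2, yb.1.1.symm⟩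
  have all : columnRowMap (columnCarrier (T ℓ p) i, rowCarrier ℓ p i) =
      (rowCarrier ℓ (Tnat p) i, columnCarrier p i) := by
    induction i with
    | zero => exact columnRowMap_highest (by omega) rfl
    | succ i ih => exact (step i ih).1
  exact ⟨all, (step i all).2⟩

theorem T_commute_Tnat (hcap : ∀ i, 1 ≤ cap i) {ℓ : ℕ} (hℓ : 1 ≤ ℓ) :
    Function.Commute (T ℓ : Config n cap → Config n cap) Tnat := fun p =>
  funext fun i => (columnRowMap_carrier hcap hℓ p i).2

theorem outCarrier_T (hcap : ∀ i, 1 ≤ cap i) {ℓ : ℕ} (hℓ : 1 ≤ ℓ) {p : Config n cap}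
    (hp : IsPath p) : outCarrier (T ℓ p) = outCarrier p := by
  obtain ⟨h1, -⟩ := eventually_columnCarrier hcap hp
  obtain ⟨h2, h0⟩ := eventually_columnCarrier hcap (isPath_T hcap ℓ hp)
  obtain ⟨i, h1, h2, h3⟩ := (h1.and (h2.and (eventually_rowCarrier hcap ℓ hp))).exists
  have := (columnRowMap_carrier hcap hℓ p i).1
  rw [h1, h2, h3, columnRowMap_highest (by omega) h0] at this
  exact congrArg Prod.snd this

/-! ### Termination of the decoding -/

/-- Letters are conserved, so no letter $\ge3$ can enter the column, and $u_\natural$ is the only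
column without one. -/
theorem columnCarrier_of_isMonochrome {p : Config n cap} (hp : IsMonochrome p) (i : ℕ) :
    columnCarrier p i = Column.highest n := by
  induction i with
  | zero => rfl
  | succ i ih =>
    refine Column.eq_highest fun k hk => ?_
    rw [columnCarrier_succ, ih] at hk
    by_contra h
    have h1 := columnRowMap_count (Column.highest n) (p i) k
    rw [hp i k (not_lt.1 h), if_pos hk,
      if_neg fun h' => h (Column.val_lt_two_of_mem_highest h')] at h1
    omega

theorem Tnat_of_isMonochrome {p : Config n cap} (hp : IsMonochrome p) : Tnat p = p := by
  funext i
  have h := columnCarrier_of_isMonochrome hp (i + 1)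
  rw [columnCarrier_succ, columnCarrier_of_isMonochrome hp i] at h
  rw [Tnat_apply, columnCarrier_of_isMonochrome hp i, columnRowMap_of_outColumn h]

theorem iterate_Tnat_of_le {p : Config n cap} {N M : ℕ} (hp : IsMonochrome (Tnat^[N] p))
    (h : N ≤ M) : Tnat^[M] p = Tnat^[N] p := by
  obtain ⟨t, rfl⟩ := Nat.exists_eq_add_of_le h
  rw [add_comm, Function.iterate_add_apply]
  exact Function.iterate_fixed (Tnat_of_isMonochrome hp) t

theorem Row.high_highest (ℓ : ℕ) : (Row.highest n ℓ).high = 0 :=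
  Row.high_eq_zero.2 fun k hk => Row.highest_count_of_ne fun h => by simp [h] at hk

/-- Conservation of letters over the first `L` positions; the initial carrier $u_\natural$
contributes none. -/
theorem prefixHigh_Tnat (p : Config n cap) (L : ℕ) :
    prefixHigh (Tnat p) L + (columnCarrier p L).high = prefixHigh p L := by
  induction L with
  | zero =>
    have h : ¬ 0 < (columnCarrier p 0).high := by
      rw [Column.high_pos]; exact (by decide : ¬ 2 ≤ 1)
    simp only [prefixHigh, Finset.range_zero, Finset.sum_empty]
    omega
  | succ L ih =>
    have := high_columnRowMap (columnCarrier p L) (p L)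
    rw [prefixHigh_succ, prefixHigh_succ, Tnat_apply, columnCarrier_succ]
    omega

/-- A column without letters $\ge3$ meeting a row that has one must pick one up, by
`lt_outColumn_bot`. -/
theorem exists_high_columnCarrier {p : Config n cap} {i : ℕ} (hi : (p i).high ≠ 0) :
    0 < (columnCarrier p i).high ∨ 0 < (columnCarrier p (i + 1)).high := by
  rw [Ne, Row.high_eq_zero] at hi
  push Not at hi
  obtain ⟨k, hk, hx⟩ := hi
  rw [Column.high_pos, Column.high_pos, columnCarrier_succ]
  by_contra! h
  have h1 := lt_outColumn_bot (b := columnCarrier p i) (x := p i) (k := k)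
    (Fin.lt_def.2 (by omega)) (Nat.pos_of_ne_zero hx)
  have h2 := Fin.lt_def.1 (columnCarrier p i).top_lt_bot
  rw [Fin.lt_def] at h1
  omega

theorem sum_prefixHigh_Tnat_lt {p : Config n cap} {L : ℕ}
    (hL : ∀ i, L ≤ i → p i = Row.highest n (cap i)) (hp : ¬ IsMonochrome p) :
    ∑ j ∈ Finset.range (L + 1), prefixHigh (Tnat p) j <
      ∑ j ∈ Finset.range (L + 1), prefixHigh p j := by
  have hle : ∀ j ∈ Finset.range (L + 1), prefixHigh (Tnat p) j ≤ prefixHigh p j := fun j _ => by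
    have := prefixHigh_Tnat p j
    omega
  obtain ⟨i, hi⟩ : ∃ i, (p i).high ≠ 0 := by
    by_contra! h
    exact hp fun i => Row.high_eq_zero.1 (h i)
  have hiL : i < L := by
    by_contra h
    exact hi (by rw [hL i (not_lt.1 h), Row.high_highest])
  rcases exists_high_columnCarrier hi with h | h
  · refine Finset.sum_lt_sum hle ⟨i, Finset.mem_range.2 (by omega), ?_⟩
    have := prefixHigh_Tnat p i
    omega
  · refine Finset.sum_lt_sum hle ⟨i + 1, Finset.mem_range.2 (by omega), ?_⟩
    have := prefixHigh_Tnat p (i + 1)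
    omega

/-- Lexicographic induction on the number of letters $\ge3$ before `L` and the sum of these numbers
over shorter prefixes. One step of `Tnat` can move the end of the support only to `L + 1`, and the
two cases below tell whether this has to be allowed. -/
theorem exists_isMonochrome (hcap : ∀ i, 1 ≤ cap i) (p : Config n cap) (L : ℕ)
    (hL : ∀ i, L ≤ i → p i = Row.highest n (cap i)) : ∃ N, IsMonochrome (Tnat^[N] p) := by
  by_cases hp : IsMonochrome p
  · exact ⟨0, hp⟩
  have h1 := prefixHigh_Tnat p L
  have hout := outColumn_highest (by have := hcap L; omega) (ℓ := cap L) (columnCarrier p L)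
  rw [← hL L le_rfl, ← columnCarrier_succ] at hout
  have succ : ∀ i, L + 1 ≤ i → Tnat p i = Row.highest n (cap i) := fun i hi => by
    rw [Tnat_apply, hL i (by omega), columnRowMap_highest (by have := hcap i; omega)
      (columnCarrier_of_highest hcap hL hi).2]
  by_cases hb : 0 < (columnCarrier p L).high
  -- Position `L` holds only letters 1 and the carrier keeps its lower entry there, so a letter
  -- $\ge3$ has left the enlarged segment for good: the first component drops although `L` grows.
  · have hlt : prefixHigh (Tnat p) (L + 1) < prefixHigh p L := by
      have h2 := prefixHigh_Tnat p (L + 1)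
      have h3 : (p L).high = 0 := by rw [hL L le_rfl, Row.high_highest]
      have h4 : 0 < (columnCarrier p (L + 1)).high := by
        rw [Column.high_pos] at hb ⊢
        rwa [hout.2]
      rw [prefixHigh_succ p, h3] at h2
      omega
    obtain ⟨N, hN⟩ := exists_isMonochrome hcap (Tnat p) (L + 1) succ
    exact ⟨N + 1, hN⟩
  -- Without letters $\ge3$ the carrier contains the letter 1 already at `L`. Position `L` is then
  -- untouched, the first component is unchanged, and the second one drops.
  · have htop : (columnCarrier p L).top = 0 := by
      rw [Column.high_pos] at hb
      have := Fin.lt_def.1 (columnCarrier p L).top_lt_bot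
      exact Fin.ext (by rw [Fin.val_zero]; omega)
    have hlt := sum_prefixHigh_Tnat_lt hL hp
    have heq : prefixHigh (Tnat p) L = prefixHigh p L := by omega
    obtain ⟨N, hN⟩ := exists_isMonochrome hcap (Tnat p) L fun i hi => by
      rcases hi.eq_or_lt with rfl | hi
      · rw [Tnat_apply, hL L le_rfl, columnRowMap_highest (by have := hcap L; omega) htop]
      · exact succ i hi
    exact ⟨N + 1, hN⟩
termination_by (prefixHigh p L, ∑ j ∈ Finset.range (L + 1), prefixHigh p j)
decreasing_by
  · exact Prod.Lex.left _ _ hlt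
  · rw [heq]; exact Prod.Lex.right _ hlt

theorem eventually_isMonochrome (hcap : ∀ i, 1 ≤ cap i) {p : Config n cap} (hp : IsPath p) :
    ∃ N₀, ∀ N ≥ N₀, IsMonochrome (Tnat^[N] p) := by
  obtain ⟨L, hL⟩ := eventually_atTop.1 hp
  obtain ⟨N₀, h⟩ := exists_isMonochrome hcap p L hL
  exact ⟨N₀, fun N hN => by rwa [iterate_Tnat_of_le h hN]⟩

end Operators

end BoxBall

/-! ### Separation of colour and dynamics -/

open Filter BoxBall in
theorem mainTheorem4 (n : ℕ) [n.AtLeastTwo] (cap : ℕ → ℕ) (hcap : ∀ i, 1 ≤ cap i)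
    (ℓ : ℕ) (hℓ : 1 ≤ ℓ) (p : Config n cap) (hp : IsPath p) :
    -- the operators are well defined on paths
    (IsPath (T ℓ p) ∧ ∀ᶠ i in atTop, rowCarrier ℓ p i = Row.highest n ℓ) ∧
    (IsPath (Tnat p) ∧ (∀ᶠ i in atTop, columnCarrier p i = outCarrier p) ∧
      (outCarrier p).top = 0) ∧
    -- the decoding terminates, with a result that does not depend on the number of steps
    (∃ N₀, ∀ N ≥ N₀, IsMonochrome (Tnat^[N] p) ∧ IsMonochrome (Tnat^[N] (T ℓ p))) ∧
    (∀ N N', IsMonochrome (Tnat^[N] p) → IsMonochrome (Tnat^[N'] p) →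
      Tnat^[N] p = Tnat^[N'] p) ∧
    -- separation of the colour degree of freedom
    (∀ N, IsMonochrome (Tnat^[N] p) → IsMonochrome (Tnat^[N] (T ℓ p)) →
      T ℓ (Tnat^[N] p) = Tnat^[N] (T ℓ p) ∧
      (∀ i, 1 ≤ i → i ≤ N →
        outCarrier (Tnat^[N - i] p) = outCarrier (Tnat^[N - i] (T ℓ p))) ∧
      colourWord N p = colourWord N (T ℓ p)) := by
  have comm : ∀ N, T ℓ (Tnat^[N] p) = Tnat^[N] (T ℓ p) := fun N =>
    (T_commute_Tnat hcap hℓ).iterate_right N p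
  -- Commutation reduces this to the invariance of the outgoing carrier under `T ℓ`, applied to the
  -- path decoded `N` times.
  have out : ∀ N, outCarrier (Tnat^[N] p) = outCarrier (Tnat^[N] (T ℓ p)) := fun N => by
    rw [← comm, outCarrier_T hcap hℓ (isPath_iterate_Tnat hcap hp N)]
  refine ⟨⟨isPath_T hcap ℓ hp, eventually_rowCarrier hcap ℓ hp⟩,
    ⟨isPath_Tnat hcap hp, eventually_columnCarrier hcap hp⟩, ?_, fun N N' h h' => ?_,
    fun N _ _ => ⟨comm N, fun i _ _ => out (N - i), ?_⟩⟩
  · obtain ⟨N₁, h₁⟩ := eventually_isMonochrome hcap hp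
    obtain ⟨N₂, h₂⟩ := eventually_isMonochrome hcap (isPath_T hcap ℓ hp)
    exact ⟨max N₁ N₂, fun N hN => ⟨h₁ N (le_trans (le_max_left _ _) hN),
      h₂ N (le_trans (le_max_right _ _) hN)⟩⟩
  · rcases le_total N N' with hN | hN
    · exact (iterate_Tnat_of_le h hN).symm
    · exact iterate_Tnat_of_le h' hN
  · simp only [colourWord, out]
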